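/- Let $p,q,r>0$ be real numbers with $p+q+r=1$, and consider the equation $$\Bigl(1-\frac px-\frac qy-rxy\Bigr)Q(x,y)=q\Bigl(1-\frac1y\Bigr)Q(x,0)+p\Bigl(1-\frac1x\Bigr)Q(0,y)\qquad(0<|x|,|y|<1).\tag{E}$$ Below, a solution means a complex-valued function $Q$ satisfying (E) that is analytic in $\{|x|,|y|<1\}$ and is the sum of a double power series $\sum_{i,j\ge0}a_{i,j}x^iy^j$, $a_{i,j}\in\mathbb C$, converging absolutely for all $|x|,|y|\le1$. Assume $r<\min(p,q)$. Then $w=2+pqrw^3$ has a smallest positive solution $w$. There exists a solution that is not identically zero, and every solution is a constant multiple of it. Every solution satisfies, for $|x|\le1$, $|y|\le 1$ with $x\neq p/q$, $y\ne q/p$ (where the apparent singularities are removable), $$Q(x,0)=\frac{Q(0,0)}{(1-qx/p)(1-rx/p)}\left(\Bigl(1-\frac x{pw}\Bigr)\sqrt{1-xqrw^2}-\frac{qx}p\Bigl(1-\frac1{qw}\Bigr)\sqrt{1-prw^2}\right),$$ $$Q(0,y)=\frac{Q(0,0)}{(1-py/q)(1-ry/q)}\left(\Bigl(1-\frac y{qw}\Bigr)\sqrt{1-yprw^2}-\frac{py}q\Bigl(1-\frac1{pw}\Bigr)\sqrt{1-qrw^2}\right),$$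 with principal square roots, and $Q(x,y)$ is then obtained by dividing (E) by $1-p/x-q/y-rxy$ wherever $0<|x|,|y|\le1$ and this factor is nonzero. If moreover $p=q$, then $w=1/p$ and, for all $|x|\le1$, $$Q(x,0)=Q(0,x)=\frac{Q(0,0)}{\sqrt{1-rx/p}}.$$ If $r\ge\min(p,q)$, then no solution other than $Q=0$ exists. -/

import Mathlib

/-- The kernel `1 - p/x - q/y - rxy` (used for `x ≠ 0` and `y ≠ 0` only). -/
noncomputable def fhKernel (p q r : ℝ) (x y : ℂ) : ℂ :=
  1 - p / x - q / y - r * x * y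

/-- `Q` solves the equation
`(1 - p/x - q/y - rxy) Q(x,y) = q (1 - 1/y) Q(x,0) + p (1 - 1/x) Q(0,y)`,
is analytic in the open unit polydisc, and is the sum of a double power series that converges
(absolutely) on the closed unit polydisc. Only the values of `Q` on the closed polydisc matter. -/
structure IsFHSolution (p q r : ℝ) (Q : ℂ → ℂ → ℂ) : Prop where
  analytic : AnalyticOnNhd ℂ (fun z : ℂ × ℂ => Q z.1 z.2) {z : ℂ × ℂ | ‖z.1‖ < 1 ∧ ‖z.2‖ < 1}
  expansion : ∃ a : ℕ → ℕ → ℂ, ∀ x y : ℂ, ‖x‖ ≤ 1 → ‖y‖ ≤ 1 →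
    HasSum (fun n : ℕ × ℕ => a n.1 n.2 * x ^ n.1 * y ^ n.2) (Q x y)
  equation : ∀ x y : ℂ, ‖x‖ < 1 → ‖y‖ < 1 → x ≠ 0 → y ≠ 0 →
    fhKernel p q r x y * Q x y = q * (1 - 1 / y) * Q x 0 + p * (1 - 1 / x) * Q 0 y

/-- `Q` is not identically zero on the closed unit polydisc. -/
def NonzeroOnPolydisc (Q : ℂ → ℂ → ℂ) : Prop :=
  ∃ x y : ℂ, ‖x‖ ≤ 1 ∧ ‖y‖ ≤ 1 ∧ Q x y ≠ 0

/-! Equation (E) says that the coefficient array a is stationary for a walk on the quarter plane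
with weights r, p, q; this is `hasSum_stationaryDefect` combined with the identity theorem for power
series.

Uniqueness. For summable a, the triangle inequality makes every stationarity defect of |a|
nonpositive, and these defects sum to (1 - p - q - r)S = 0. Hence |a| is stationary too, and a zero
of a at (m, n) spreads to (m+1, n) and (m, n+1). So a is determined by a(0,0).

Nonexistence. For the generating function B of |a|, setting y = 1 in the equation leaves (p - rs)
B(s,1) = p B(0,1). If p ≤ r, letting s rise to p/r ≤ 1 gives B(0,1) = 0, so a(0,0) = 0. The case q ≤
r follows by exchanging the variables.

Existence. The claimed boundary functions f, g must make q x(y-1)f(x) + p y(x-1)g(y) vanish on the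
curve K = xy - py - qx - r x²y² = 0. The cubic for w is exactly the condition under which (1 -
xqrw²)(1 - yprw²) is the square (1 - rwxy)² on K = 0 (`sqrt_mul_sqrt_eq`); the vanishing follows by
algebra (`fhBoundary_vanishing`). Division by K takes place on a torus |x| = |y| = ρ with ρ slightly
above 1. There K has no zero, and for x on the circle K, as a quadratic in y, has at most one root
inside, where the numerator vanishes. So the Laurent coefficients of the quotient with a negative
index are zero, and the others form a summable stationary array with boundary functions f, g
(`exists_stationary_of_vanishing`).

Minimality of w is what places the branch points 1/(qrw²) and 1/(prw²) outside the closed unit disc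
(`IsLeast.mul_mul_sq_lt_one`). -/

/-- The defect of `a` in the stationarity equation of the walk on `ℕ × ℕ` which steps by `(1, 1)`,
`(-1, 0)`, `(0, -1)` with weights `r`, `p`, `q`, the last two being suppressed at the boundary. -/
def stationaryDefect {𝕜 : Type*} [Field 𝕜] (p q r : 𝕜) (a : ℕ → ℕ → 𝕜) (m n : ℕ) : 𝕜 :=
  a m n - ((if 1 ≤ m ∧ 1 ≤ n then r * a (m - 1) (n - 1) else 0) + p * a (m + 1) n
    + q * a m (n + 1) + (if m = 0 then p * a 0 n else 0) + (if n = 0 then q * a m 0 else 0))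

/-! ### Generating functions of shifted arrays -/

section HasSum

variable {𝕜 : Type*} [RCLike 𝕜] {a : ℕ → ℕ → 𝕜} {x y S S₁ S₂ : 𝕜}

theorem hasSum_ite_fst (h : HasSum (fun n => a 0 n * y ^ n) S₂) :
    HasSum (fun n : ℕ × ℕ => if n.1 = 0 then a 0 n.2 * y ^ n.2 else 0) S₂ := by
  have hinj : Function.Injective (fun n : ℕ => ((0, n) : ℕ × ℕ)) := fun i j h => by simpa using h
  rw [← hinj.hasSum_iff]
  · simpa [Function.comp_def] using h
  · rintro ⟨i, j⟩ hij
    have : i ≠ 0 := fun h => hij ⟨j, by simp [h]⟩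
    simp [this]

theorem hasSum_succ_fst (hx : x ≠ 0)
    (h : HasSum (fun n : ℕ × ℕ => a n.1 n.2 * x ^ n.1 * y ^ n.2) S)
    (h₂ : HasSum (fun n => a 0 n * y ^ n) S₂) :
    HasSum (fun n : ℕ × ℕ => a (n.1 + 1) n.2 * x ^ n.1 * y ^ n.2) ((S - S₂) / x) := by
  have hinj : Function.Injective (fun n : ℕ × ℕ => ((n.1 + 1, n.2) : ℕ × ℕ)) := by
    rintro ⟨i, j⟩ ⟨k, l⟩ h
    simpa using h
  have h3 := (h.sub (hasSum_ite_fst h₂)).div_const x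
  rw [← hinj.hasSum_iff] at h3
  · refine HasSum.congr_fun h3 ?_
    rintro ⟨i, j⟩
    simp only [Function.comp_apply, Nat.add_eq_zero_iff, one_ne_zero, and_false, if_false, sub_zero]
    field_simp
    ring
  · rintro ⟨i, j⟩ hij
    have : i = 0 := by
      by_contra h
      exact hij ⟨(i - 1, j), by simp; omega⟩
    simp [this]

theorem hasSum_swap_iff {f : ℕ × ℕ → 𝕜} : HasSum (fun n : ℕ × ℕ => f n.swap) S ↔ HasSum f S :=
  (Equiv.prodComm ℕ ℕ).hasSum_iff (f := f)

theorem hasSum_succ_snd (hy : y ≠ 0)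
    (h : HasSum (fun n : ℕ × ℕ => a n.1 n.2 * x ^ n.1 * y ^ n.2) S)
    (h₁ : HasSum (fun n => a n 0 * x ^ n) S₁) :
    HasSum (fun n : ℕ × ℕ => a n.1 (n.2 + 1) * x ^ n.1 * y ^ n.2) ((S - S₁) / y) := by
  rw [← hasSum_swap_iff] at h ⊢
  simp only [Prod.fst_swap, Prod.snd_swap, mul_right_comm _ (x ^ _) (y ^ _)] at h ⊢
  exact hasSum_succ_fst (a := fun m n => a n m) hy h h₁

theorem hasSum_ite_snd (h : HasSum (fun n => a n 0 * x ^ n) S₁) :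
    HasSum (fun n : ℕ × ℕ => if n.2 = 0 then a n.1 0 * x ^ n.1 else 0) S₁ := by
  rw [← hasSum_swap_iff]
  exact hasSum_ite_fst (a := fun m n => a n m) h

theorem hasSum_pred_pred (h : HasSum (fun n : ℕ × ℕ => a n.1 n.2 * x ^ n.1 * y ^ n.2) S) :
    HasSum (fun n : ℕ × ℕ => if 1 ≤ n.1 ∧ 1 ≤ n.2 then
      a (n.1 - 1) (n.2 - 1) * x ^ n.1 * y ^ n.2 else 0) (x * y * S) := by
  have hinj : Function.Injective (fun n : ℕ × ℕ => ((n.1 + 1, n.2 + 1) : ℕ × ℕ)) := by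
    rintro ⟨i, j⟩ ⟨k, l⟩ h
    simpa using h
  rw [← hinj.hasSum_iff]
  · refine HasSum.congr_fun (h.mul_left (x * y)) ?_
    rintro ⟨i, j⟩
    simp
    ring
  · rintro ⟨i, j⟩ hij
    rw [if_neg]
    rintro ⟨h1, h2⟩
    exact hij ⟨(i - 1, j - 1), by simp at h1 h2 ⊢; omega⟩

/-- Each step of the walk shifts the series: dividing by x or y loses the boundary series, and the
suppressed steps restore pS₂ and qS₁. The field is left general because the identity is used for a
over ℂ and for ‖a‖ over ℝ. -/
theorem hasSum_stationaryDefect (p q r : 𝕜) (hx : x ≠ 0) (hy : y ≠ 0)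
    (h : HasSum (fun n : ℕ × ℕ => a n.1 n.2 * x ^ n.1 * y ^ n.2) S)
    (h₁ : HasSum (fun n => a n 0 * x ^ n) S₁) (h₂ : HasSum (fun n => a 0 n * y ^ n) S₂) :
    HasSum (fun n : ℕ × ℕ => stationaryDefect p q r a n.1 n.2 * x ^ n.1 * y ^ n.2)
      ((1 - p / x - q / y - r * x * y) * S - (q * (1 - 1 / y) * S₁ + p * (1 - 1 / x) * S₂)) := by
  have := h.sub ((((((hasSum_pred_pred h).mul_left r).add
    ((hasSum_succ_fst hx h h₂).mul_left p)).add ((hasSum_succ_snd hy h h₁).mul_left q)).add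
    ((hasSum_ite_fst h₂).mul_left p)).add ((hasSum_ite_snd h₁).mul_left q))
  have e : (1 - p / x - q / y - r * x * y) * S - (q * (1 - 1 / y) * S₁ + p * (1 - 1 / x) * S₂)
      = S - (r * (x * y * S) + p * ((S - S₂) / x) + q * ((S - S₁) / y) + p * S₂ + q * S₁) := by
    field_simp
    ring
  rw [e]
  refine HasSum.congr_fun this ?_
  rintro ⟨i, j⟩
  simp only [stationaryDefect]
  by_cases hi : i = 0 <;> by_cases hj : j = 0 <;> simp [hi, hj, Nat.one_le_iff_ne_zero] <;> ring

end HasSum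

/-! ### Summable stationary arrays: uniqueness and nonexistence -/

section Uniqueness

variable {p q r : ℝ}

theorem summable_mul_pow_mul_pow {a : ℕ → ℕ → ℂ} (ha : Summable (fun n : ℕ × ℕ => a n.1 n.2))
    {x y : ℂ} (hx : ‖x‖ ≤ 1) (hy : ‖y‖ ≤ 1) :
    Summable (fun n : ℕ × ℕ => a n.1 n.2 * x ^ n.1 * y ^ n.2) := by
  refine Summable.of_norm_bounded ha.norm fun n => ?_
  rw [norm_mul, norm_mul, norm_pow, norm_pow, mul_assoc]
  exact mul_le_of_le_one_right (norm_nonneg _)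
    (mul_le_one₀ (pow_le_one₀ (norm_nonneg _) hx) (by positivity) (pow_le_one₀ (norm_nonneg _) hy))

theorem hasSum_of_hasSum_snd_zero {a : ℕ → ℕ → ℂ} {x S : ℂ}
    (h : HasSum (fun n : ℕ × ℕ => a n.1 n.2 * x ^ n.1 * 0 ^ n.2) S) :
    HasSum (fun n => a n 0 * x ^ n) S := by
  have hinj : Function.Injective (fun n : ℕ => ((n, 0) : ℕ × ℕ)) := fun i j h => by simpa using h
  rw [← hinj.hasSum_iff] at h
  · simpa [Function.comp_def] using h
  · rintro ⟨i, j⟩ hij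
    have : j ≠ 0 := fun h => hij ⟨i, by simp [h]⟩
    simp [this]

theorem hasSum_of_hasSum_fst_zero {a : ℕ → ℕ → ℂ} {y S : ℂ}
    (h : HasSum (fun n : ℕ × ℕ => a n.1 n.2 * 0 ^ n.1 * y ^ n.2) S) :
    HasSum (fun n => a 0 n * y ^ n) S := by
  rw [← hasSum_swap_iff] at h
  simp only [Prod.fst_swap, Prod.snd_swap, mul_right_comm _ (0 ^ _) (y ^ _)] at h
  exact hasSum_of_hasSum_snd_zero (a := fun m n => a n m) h

/-- If `a` is summable and stationary, then so is `‖a‖`. -/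
theorem stationaryDefect_norm_eq_zero (hp : 0 < p) (hq : 0 < q) (hr : 0 < r)
    (hpqr : p + q + r = 1) {a : ℕ → ℕ → ℂ} (ha : Summable (fun n : ℕ × ℕ => a n.1 n.2))
    (hst : ∀ m n, stationaryDefect (p : ℂ) q r a m n = 0) (m n : ℕ) :
    stationaryDefect p q r (fun m n => ‖a m n‖) m n = 0 := by
  have h1 := ha.norm
  have hS := h1.hasSum
  have hS1 := (h1.comp_injective (i := fun n : ℕ => ((n, 0) : ℕ × ℕ))
    (fun i j h => by simpa using h)).hasSum
  have hS2 := (h1.comp_injective (i := fun n : ℕ => ((0, n) : ℕ × ℕ))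
    (fun i j h => by simpa using h)).hasSum
  have key := hasSum_stationaryDefect (a := fun m n => ‖a m n‖) (x := 1) (y := 1) p q r one_ne_zero
    one_ne_zero (by simpa using hS) (by simpa [Function.comp_def] using hS1)
    (by simpa [Function.comp_def] using hS2)
  have e : 1 - p - q - r = 0 := by linarith
  simp only [one_pow, mul_one, div_one, sub_self, mul_zero, zero_mul, add_zero, e] at key
  -- At x = y = 1 the defects of ‖a‖ sum to 0, so it is enough that none is positive; this is the
  -- triangle inequality applied to the equation for a.
  have hle : ∀ n : ℕ × ℕ, 0 ≤ -stationaryDefect p q r (fun m n => ‖a m n‖) n.1 n.2 := by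
    rintro ⟨m, n⟩
    have h := hst m n
    have hn : ∀ s : ℝ, 0 < s → ∀ z : ℂ, ‖(s : ℂ) * z‖ = s * ‖z‖ := fun s hs z => by
      rw [norm_mul, Complex.norm_of_nonneg hs.le]
    simp only [stationaryDefect] at h ⊢
    rw [sub_eq_zero] at h
    have h2 : ‖a m n‖ ≤ ((if 1 ≤ m ∧ 1 ≤ n then r * ‖a (m - 1) (n - 1)‖ else 0)
      + p * ‖a (m + 1) n‖ + q * ‖a m (n + 1)‖ + (if m = 0 then p * ‖a 0 n‖ else 0)
      + (if n = 0 then q * ‖a m 0‖ else 0)) := by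
      conv_lhs => rw [h]
      refine (norm_add_le _ _).trans (add_le_add ((norm_add_le _ _).trans (add_le_add
        ((norm_add_le _ _).trans (add_le_add ((norm_add_le _ _).trans (add_le_add ?_ ?_)) ?_)) ?_))
        ?_)
      · split_ifs <;> simp [abs_of_pos hr]
      · rw [hn p hp]
      · rw [hn q hq]
      · split_ifs <;> simp [abs_of_pos hp]
      · split_ifs <;> simp [abs_of_pos hq]
    linarith
  have hz := (hasSum_zero_iff_of_nonneg hle).1 (by simpa using key.neg)
  have := congrFun hz (m, n)
  simpa using this

/-- A summable stationary array that vanishes at the origin vanishes. -/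
theorem eq_zero_of_stationaryDefect_eq_zero (hp : 0 < p) (hq : 0 < q) (hr : 0 < r)
    (hpqr : p + q + r = 1) {a : ℕ → ℕ → ℂ} (ha : Summable (fun n : ℕ × ℕ => a n.1 n.2))
    (hst : ∀ m n, stationaryDefect (p : ℂ) q r a m n = 0) (h0 : a 0 0 = 0) (m n : ℕ) :
    a m n = 0 := by
  have hb := stationaryDefect_norm_eq_zero hp hq hr hpqr ha hst
  -- Where ‖a‖ vanishes its defect is minus a sum of nonnegative terms, so each term vanishes.
  have step : ∀ m n, a m n = 0 → a (m + 1) n = 0 ∧ a m (n + 1) = 0 := by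
    intro m n h
    have h1 := hb m n
    simp only [stationaryDefect, h, norm_zero, zero_sub, neg_eq_zero] at h1
    have t1 : 0 ≤ (if 1 ≤ m ∧ 1 ≤ n then r * ‖a (m - 1) (n - 1)‖ else 0) := by
      split_ifs <;> positivity
    have t2 : 0 ≤ (if m = 0 then p * ‖a 0 n‖ else 0) := by split_ifs <;> positivity
    have t3 : 0 ≤ (if n = 0 then q * ‖a m 0‖ else 0) := by split_ifs <;> positivity
    have t4 : 0 ≤ p * ‖a (m + 1) n‖ := by positivity
    have t5 : 0 ≤ q * ‖a m (n + 1)‖ := by positivity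
    have e1 : p * ‖a (m + 1) n‖ = 0 := by linarith
    have e2 : q * ‖a m (n + 1)‖ = 0 := by linarith
    simpa [hp.ne', hq.ne'] using And.intro e1 e2
  have row : ∀ m, a m 0 = 0 := fun m => by
    induction m with
    | zero => exact h0
    | succ m ih => exact (step m 0 ih).1
  induction n with
  | zero => exact row m
  | succ n ih => exact (step m n ih).2

theorem stationaryDefect_swap {𝕜 : Type*} [Field 𝕜] (p q r : 𝕜) (a : ℕ → ℕ → 𝕜) (m n : ℕ) :
    stationaryDefect q p r (fun i j => a j i) m n = stationaryDefect p q r a n m := by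
  simp only [stationaryDefect, and_comm]
  ring

/-- At y = 1 the kernel factors as (1 - 1/s)(p - rs), and the first factor cancels against the
right-hand side. The remaining factor tends to 0 as s rises to p/r, a point of the closed disc
because p ≤ r. This forces the column sum T = ∑ ‖a 0 n‖ to be 0. -/
theorem eq_zero_of_le_of_stationaryDefect_eq_zero (hp : 0 < p) (hq : 0 < q) (hr : 0 < r)
    (hpqr : p + q + r = 1) (hpr : p ≤ r) {a : ℕ → ℕ → ℂ}
    (ha : Summable (fun n : ℕ × ℕ => a n.1 n.2))
    (hst : ∀ m n, stationaryDefect (p : ℂ) q r a m n = 0) (m n : ℕ) :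
    a m n = 0 := by
  refine eq_zero_of_stationaryDefect_eq_zero hp hq hr hpqr ha hst ?_ m n
  have hb := stationaryDefect_norm_eq_zero hp hq hr hpqr ha hst
  have h1 := ha.norm
  have hS2 := h1.comp_injective (i := fun n : ℕ => ((0, n) : ℕ × ℕ)) (fun i j h => by simpa using h)
  set S := ∑' n : ℕ × ℕ, ‖a n.1 n.2‖
  set T := ∑' n : ℕ, ‖a 0 n‖
  have hT : HasSum (fun n => ‖a 0 n‖) T := hS2.hasSum
  have key : ∀ s : ℝ, 0 < s → s < p / r → p * T ≤ (p - r * s) * S := by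
    intro s hs hsp
    have hs1 : s < 1 := hsp.trans_le ((div_le_one hr).2 hpr)
    have hsr : 0 < p - r * s := by
      rw [lt_div_iff₀ hr] at hsp
      linarith
    have hle : ∀ n : ℕ × ℕ, ‖a n.1 n.2‖ * s ^ n.1 ≤ ‖a n.1 n.2‖ := fun n =>
      mul_le_of_le_one_right (norm_nonneg _) (pow_le_one₀ hs.le hs1.le)
    have hsm : Summable fun n : ℕ × ℕ => ‖a n.1 n.2‖ * s ^ n.1 :=
      h1.of_nonneg_of_le (fun n => by positivity) hle
    have hrow : Summable fun n : ℕ => ‖a n 0‖ * s ^ n :=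
      hsm.comp_injective (i := fun n : ℕ => ((n, 0) : ℕ × ℕ)) (fun i j h => by simpa using h)
    have h2 := hasSum_stationaryDefect (a := fun m n => ‖a m n‖) (x := s) (y := 1) p q r hs.ne'
      one_ne_zero (by simpa using hsm.hasSum) hrow.hasSum (by simpa using hT)
    simp only [hb, zero_mul] at h2
    have h3 := h2.unique hasSum_zero
    have h4 : (1 - 1 / s) * ((p - r * s) * ∑' n : ℕ × ℕ, ‖a n.1 n.2‖ * s ^ n.1)
        = (1 - 1 / s) * (p * T) := by
      have : 1 - p / s - q / 1 - r * s * 1 = (1 - 1 / s) * (p - r * s) := by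
        have : q = 1 - p - r := by linarith
        subst this
        field_simp
        ring
      rw [this] at h3
      linear_combination h3
    have h5 := mul_left_cancel₀ (by rw [sub_ne_zero]; exact ((one_lt_div hs).2 hs1).ne) h4
    rw [← h5]
    exact mul_le_mul_of_nonneg_left (hsm.tsum_le_tsum hle h1) hsr.le
  have hlim : Filter.Tendsto (fun s : ℝ => (p - r * s) * S) (nhdsWithin (p / r) (Set.Iio (p / r)))
      (nhds ((p - r * (p / r)) * S)) :=
    Filter.Tendsto.mono_left (Continuous.tendsto (by fun_prop) _) nhdsWithin_le_nhds
  have hle := ge_of_tendsto hlim (b := p * T) (by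
    filter_upwards [Ioo_mem_nhdsLT (div_pos hp hr)] with s hs using key s hs.1 hs.2)
  rw [mul_div_cancel₀ _ hr.ne', sub_self, zero_mul] at hle
  have h6 := hT.tsum_eq ▸ hS2.le_tsum 0 (fun _ _ => norm_nonneg _)
  have h7 : ‖a 0 0‖ ≤ T := h6
  have h8 : T ≤ 0 := by nlinarith
  simpa using h7.trans h8

end Uniqueness

/-! ### Coefficient uniqueness and analyticity of power series -/

theorem eq_zero_of_hasSum_pow_zero {e : ℕ → ℂ}
    (h : ∀ x : ℂ, x ≠ 0 → ‖x‖ < 1 → HasSum (fun n => e n * x ^ n) 0) : e = 0 := by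
  have h0 : ∀ᶠ z : ℂ in nhdsWithin 0 {0}ᶜ, HasSum (fun n => e n * z ^ n) 0 := by
    filter_upwards [self_mem_nhdsWithin, mem_nhdsWithin_of_mem_nhds (Metric.ball_mem_nhds 0 one_pos)]
      with z hz hz1 using h z hz (by simpa using hz1)
  have hps : HasFPowerSeriesAt (fun z : ℂ => ∑' n, e n * z ^ n)
      (FormalMultilinearSeries.ofScalars ℂ e) 0 := by
    rw [hasFPowerSeriesAt_iff]
    filter_upwards [Metric.ball_mem_nhds 0 one_pos] with z hz
    simp only [FormalMultilinearSeries.coeff_ofScalars, smul_eq_mul, mul_comm (z ^ _), zero_add]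
    by_cases hz0 : z = 0
    · subst hz0
      exact (summable_of_ne_finset_zero (s := {0}) fun n hn => by simp_all).hasSum
    · exact (h z hz0 (by simpa using hz)).summable.hasSum
  have hfreq : ∀ᶠ z : ℂ in nhds 0, ∑' n, e n * z ^ n = 0 := by
    rw [← hps.analyticAt.frequently_zero_iff_eventually_zero]
    exact (h0.mono fun z hz => hz.tsum_eq).frequently
  have := hps.eq_zero_of_eventually hfreq
  exact (FormalMultilinearSeries.ofScalars_series_eq_zero ℂ).1 this

theorem eq_zero_of_hasSum_pow_mul_pow_zero {d : ℕ → ℕ → ℂ}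
    (h : ∀ x y : ℂ, x ≠ 0 → y ≠ 0 → ‖x‖ < 1 → ‖y‖ < 1 →
      HasSum (fun n : ℕ × ℕ => d n.1 n.2 * x ^ n.1 * y ^ n.2) 0) (m n : ℕ) : d m n = 0 := by
  have hrow : ∀ y : ℂ, y ≠ 0 → ‖y‖ < 1 → (fun m => ∑' n, d m n * y ^ n) = 0 := by
    intro y hy hy1
    refine eq_zero_of_hasSum_pow_zero fun x hx hx1 => ?_
    have h1 := h x y hx hy hx1 hy1
    have h2 := h1.prod_fiberwise fun m => (h1.summable.prod_factor m).hasSum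
    refine h2.congr_fun fun m => ?_
    rw [mul_comm, ← tsum_mul_left]
    exact tsum_congr fun n => by ring
  have hcol : (fun n => d m n) = 0 := by
    refine eq_zero_of_hasSum_pow_zero fun y hy hy1 => ?_
    have hs : Summable fun n => d m n * y ^ n := by
      have h1 := (h (1 / 2) y (by norm_num) hy (by norm_num) hy1).summable.prod_factor m
      refine ((h1.mul_left (2 ^ m)).congr fun n => ?_)
      field_simp
      ring_nf
      simp
    rw [← show ∑' n, d m n * y ^ n = 0 from congrFun (hrow y hy hy1) m]
    exact hs.hasSum
  exact congrFun hcol n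

/-- The homogeneous part of degree `N` of the double power series with coefficients `a`. -/
noncomputable def doublePowerSeries (a : ℕ → ℕ → ℂ) : FormalMultilinearSeries ℂ (ℂ × ℂ) ℂ :=
  fun N => ∑ k ∈ Finset.HasAntidiagonal.antidiagonal N, a k.1 k.2 •
    (ContinuousMultilinearMap.mkPiAlgebraFin ℂ N ℂ).compContinuousLinearMap
      (fun i => if i.1 < k.1 then ContinuousLinearMap.fst ℂ ℂ ℂ
        else ContinuousLinearMap.snd ℂ ℂ ℂ)

theorem doublePowerSeries_apply (a : ℕ → ℕ → ℂ) (N : ℕ) (z : ℂ × ℂ) :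
    doublePowerSeries a N (fun _ => z)
      = ∑ k ∈ Finset.HasAntidiagonal.antidiagonal N, a k.1 k.2 * z.1 ^ k.1 * z.2 ^ k.2 := by
  rw [doublePowerSeries, sum_apply]
  refine Finset.sum_congr rfl fun k hk => ?_
  rw [Finset.HasAntidiagonal.mem_antidiagonal] at hk
  rw [smul_apply,
    ContinuousMultilinearMap.compContinuousLinearMap_apply,
    ContinuousMultilinearMap.mkPiAlgebraFin_apply, List.prod_ofFn, smul_eq_mul, mul_assoc]
  congr 1
  have : ∀ i : Fin N, (if i.1 < k.1 then ContinuousLinearMap.fst ℂ ℂ ℂ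
        else ContinuousLinearMap.snd ℂ ℂ ℂ) z = if i.1 < k.1 then z.1 else z.2 := by
    intro i
    split_ifs <;> rfl
  simp only [this]
  rw [Fin.prod_univ_eq_prod_range (fun i => if i < k.1 then z.1 else z.2) N, ← hk,
    Finset.prod_range_add]
  congr 1
  · rw [Finset.prod_congr rfl fun i hi => if_pos (Finset.mem_range.1 hi)]
    simp
  · simp

theorem norm_doublePowerSeries_le (a : ℕ → ℕ → ℂ) (N : ℕ) :
    ‖doublePowerSeries a N‖ ≤ ∑ k ∈ Finset.HasAntidiagonal.antidiagonal N, ‖a k.1 k.2‖ := by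
  refine (norm_sum_le _ _).trans (Finset.sum_le_sum fun k _ => ?_)
  rw [norm_smul]
  refine mul_le_of_le_one_right (norm_nonneg _) ?_
  refine (ContinuousMultilinearMap.norm_compContinuousLinearMap_le _ _).trans ?_
  refine mul_le_one₀ (by simp) (Finset.prod_nonneg fun _ _ => norm_nonneg _)
    (Finset.prod_le_one (fun _ _ => norm_nonneg _) fun i _ => ?_)
  split_ifs
  · exact ContinuousLinearMap.norm_fst_le _ _ _
  · exact ContinuousLinearMap.norm_snd_le _ _ _

/-- The norm on ℂ × ℂ is the maximum, so the unit ball is the polydisc; grouping terms by total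
degree gives a power series whose homogeneous parts have norm at most the total sum of ‖a‖. -/
theorem analyticOnNhd_tsum_pow_mul_pow {a : ℕ → ℕ → ℂ}
    (ha : Summable (fun n : ℕ × ℕ => a n.1 n.2)) {Q : ℂ → ℂ → ℂ}
    (h : ∀ x y : ℂ, ‖x‖ < 1 → ‖y‖ < 1 →
      HasSum (fun n : ℕ × ℕ => a n.1 n.2 * x ^ n.1 * y ^ n.2) (Q x y)) :
    AnalyticOnNhd ℂ (fun z : ℂ × ℂ => Q z.1 z.2) {z : ℂ × ℂ | ‖z.1‖ < 1 ∧ ‖z.2‖ < 1} := by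
  have hball : HasFPowerSeriesOnBall (fun z : ℂ × ℂ => Q z.1 z.2) (doublePowerSeries a) 0 1 := by
    refine ⟨?_, one_pos, ?_⟩
    · refine FormalMultilinearSeries.le_radius_of_bound (r := 1) _ (∑' n : ℕ × ℕ, ‖a n.1 n.2‖)
        fun N => ?_
      simp only [NNReal.coe_one, one_pow, mul_one]
      exact (norm_doublePowerSeries_le a N).trans
        (ha.norm.sum_le_tsum _ fun _ _ => norm_nonneg _)
    · rintro ⟨x, y⟩ hz
      have hz' : ‖x‖ < 1 ∧ ‖y‖ < 1 := by
        rw [Metric.mem_eball, edist_zero_right, ← ofReal_norm, ← ENNReal.ofReal_one,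
          ENNReal.ofReal_lt_ofReal_iff one_pos, Prod.norm_def, max_lt_iff] at hz
        exact hz
      have h1 := h x y hz'.1 hz'.2
      rw [← Finset.HasAntidiagonal.sigmaAntidiagonalEquivProd.hasSum_iff] at h1
      have h2 := h1.sigma fun N => hasSum_fintype _
      simp only [zero_add]
      refine h2.congr_fun fun N => ?_
      rw [doublePowerSeries_apply, ← Finset.sum_coe_sort]
      rfl
  refine hball.analyticOnNhd.mono ?_
  rintro ⟨x, y⟩ hz
  rw [Metric.mem_eball, edist_zero_right, ← ofReal_norm, ← ENNReal.ofReal_one,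
    ENNReal.ofReal_lt_ofReal_iff one_pos, Prod.norm_def, max_lt_iff]
  exact hz

/-! ### Solutions of (E) as stationary arrays -/

section Solutions

variable {p q r : ℝ} {Q : ℂ → ℂ → ℂ} {a : ℕ → ℕ → ℂ}

theorem stationaryDefect_sub_mul {𝕜 : Type*} [Field 𝕜] (p q r c : 𝕜) (a b : ℕ → ℕ → 𝕜) (m n : ℕ) :
    stationaryDefect p q r (fun m n => a m n - c * b m n) m n
      = stationaryDefect p q r a m n - c * stationaryDefect p q r b m n := by
  simp only [stationaryDefect]
  split_ifs <;> ring

theorem summable_of_expansion (h : ∀ x y : ℂ, ‖x‖ ≤ 1 → ‖y‖ ≤ 1 →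
      HasSum (fun n : ℕ × ℕ => a n.1 n.2 * x ^ n.1 * y ^ n.2) (Q x y)) :
    Summable (fun n : ℕ × ℕ => a n.1 n.2) := by
  simpa using (h 1 1 (by simp) (by simp)).summable

theorem equation_of_stationaryDefect (h : ∀ x y : ℂ, ‖x‖ ≤ 1 → ‖y‖ ≤ 1 →
      HasSum (fun n : ℕ × ℕ => a n.1 n.2 * x ^ n.1 * y ^ n.2) (Q x y))
    (hst : ∀ m n, stationaryDefect (p : ℂ) q r a m n = 0) {x y : ℂ} (hx : ‖x‖ ≤ 1) (hy : ‖y‖ ≤ 1)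
    (hx0 : x ≠ 0) (hy0 : y ≠ 0) :
    fhKernel p q r x y * Q x y = q * (1 - 1 / y) * Q x 0 + p * (1 - 1 / x) * Q 0 y := by
  have h1 := hasSum_stationaryDefect (p : ℂ) q r hx0 hy0 (h x y hx hy)
    (hasSum_of_hasSum_snd_zero (h x 0 hx (by simp)))
    (hasSum_of_hasSum_fst_zero (h 0 y (by simp) hy))
  simp only [hst, zero_mul] at h1
  exact sub_eq_zero.1 (h1.unique hasSum_zero)

theorem isFHSolution_of_stationaryDefect (h : ∀ x y : ℂ, ‖x‖ ≤ 1 → ‖y‖ ≤ 1 →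
      HasSum (fun n : ℕ × ℕ => a n.1 n.2 * x ^ n.1 * y ^ n.2) (Q x y))
    (hst : ∀ m n, stationaryDefect (p : ℂ) q r a m n = 0) : IsFHSolution p q r Q where
  analytic := analyticOnNhd_tsum_pow_mul_pow (summable_of_expansion h)
    fun x y hx hy => h x y hx.le hy.le
  expansion := ⟨a, h⟩
  equation _ _ hx hy hx0 hy0 := equation_of_stationaryDefect h hst hx.le hy.le hx0 hy0

theorem IsFHSolution.stationaryDefect_eq_zero (hQ : IsFHSolution p q r Q)
    (h : ∀ x y : ℂ, ‖x‖ ≤ 1 → ‖y‖ ≤ 1 →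
      HasSum (fun n : ℕ × ℕ => a n.1 n.2 * x ^ n.1 * y ^ n.2) (Q x y)) (m n : ℕ) :
    stationaryDefect (p : ℂ) q r a m n = 0 := by
  refine eq_zero_of_hasSum_pow_mul_pow_zero (d := stationaryDefect (p : ℂ) q r a)
    (fun x y hx0 hy0 hx hy => ?_) m n
  have h1 := hasSum_stationaryDefect (p : ℂ) q r hx0 hy0 (h x y hx.le hy.le)
    (hasSum_of_hasSum_snd_zero (h x 0 hx.le (by simp)))
    (hasSum_of_hasSum_fst_zero (h 0 y (by simp) hy.le))
  have h2 := sub_eq_zero.2 (hQ.equation x y hx hy hx0 hy0)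
  rw [fhKernel] at h2
  rwa [h2] at h1

/-- Stationarity of the coefficients carries the equation from the open to the closed polydisc. -/
theorem IsFHSolution.equation_closed (hQ : IsFHSolution p q r Q) {x y : ℂ} (hx : ‖x‖ ≤ 1)
    (hy : ‖y‖ ≤ 1) (hx0 : x ≠ 0) (hy0 : y ≠ 0) :
    fhKernel p q r x y * Q x y = q * (1 - 1 / y) * Q x 0 + p * (1 - 1 / x) * Q 0 y := by
  obtain ⟨a, h⟩ := hQ.expansion
  exact equation_of_stationaryDefect h (hQ.stationaryDefect_eq_zero h) hx hy hx0 hy0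

theorem IsFHSolution.eq_mul (hp : 0 < p) (hq : 0 < q) (hr : 0 < r) (hpqr : p + q + r = 1)
    {Q₀ : ℂ → ℂ → ℂ} (hQ₀ : IsFHSolution p q r Q₀) (h0 : Q₀ 0 0 = 1) (hQ : IsFHSolution p q r Q)
    {x y : ℂ} (hx : ‖x‖ ≤ 1) (hy : ‖y‖ ≤ 1) : Q x y = Q 0 0 * Q₀ x y := by
  obtain ⟨a, h⟩ := hQ.expansion
  obtain ⟨b, hb⟩ := hQ₀.expansion
  have hzero : ∀ {a : ℕ → ℕ → ℂ} {Q : ℂ → ℂ → ℂ}, (∀ x y : ℂ, ‖x‖ ≤ 1 → ‖y‖ ≤ 1 →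
      HasSum (fun n : ℕ × ℕ => a n.1 n.2 * x ^ n.1 * y ^ n.2) (Q x y)) → a 0 0 = Q 0 0 := by
    intro a Q h
    have h1 := hasSum_of_hasSum_snd_zero (h 0 0 (by simp) (by simp))
    refine HasSum.unique ?_ h1
    convert hasSum_single (f := fun n => a n 0 * (0 : ℂ) ^ n) 0 (fun n hn => by simp [hn]) using 1
    simp
  have hd := fun m n => eq_zero_of_stationaryDefect_eq_zero hp hq hr hpqr
    (a := fun m n => a m n - Q 0 0 * b m n)
    ((summable_of_expansion h).sub ((summable_of_expansion hb).mul_left (Q 0 0)))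
    (fun m n => by
      rw [stationaryDefect_sub_mul, hQ.stationaryDefect_eq_zero h,
        hQ₀.stationaryDefect_eq_zero hb, mul_zero, sub_zero])
    (by simp [hzero h, hzero hb, h0]) m n
  refine (h x y hx hy).unique (((hb x y hx hy).mul_left (Q 0 0)).congr_fun fun n => ?_)
  rw [sub_eq_zero.1 (hd n.1 n.2)]
  ring

theorem IsFHSolution.eq_zero_of_min_le (hp : 0 < p) (hq : 0 < q) (hr : 0 < r)
    (hpqr : p + q + r = 1) (h : min p q ≤ r) (hQ : IsFHSolution p q r Q) {x y : ℂ} (hx : ‖x‖ ≤ 1)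
    (hy : ‖y‖ ≤ 1) : Q x y = 0 := by
  obtain ⟨a, ha⟩ := hQ.expansion
  have hst := hQ.stationaryDefect_eq_zero ha
  have hs := summable_of_expansion ha
  have hz : ∀ m n, a m n = 0 := by
    rcases min_le_iff.1 h with h | h
    · exact eq_zero_of_le_of_stationaryDefect_eq_zero hp hq hr hpqr h hs hst
    · exact fun m n => eq_zero_of_le_of_stationaryDefect_eq_zero (a := fun m n => a n m) hq hp hr
        (by linarith) h (hasSum_swap_iff.2 hs.hasSum).summable
        (fun m n => (stationaryDefect_swap (p : ℂ) q r a m n).trans (hst n m)) n m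
  have := ha x y hx hy
  simp only [hz, zero_mul] at this
  exact this.unique hasSum_zero

end Solutions

/-! ### The smallest positive root w -/

section Root

variable {p q r w : ℝ}

theorem mul_mul_le_of_add_add_eq_one (hp : 0 < p) (hq : 0 < q) (hr : 0 < r)
    (hpqr : p + q + r = 1) : p * q * r ≤ 1 / 27 := by
  have : r = 1 - p - q := by linarith
  subst this
  nlinarith [sq_nonneg (p - q), sq_nonneg (p - (1 - p - q)), sq_nonneg (q - (1 - p - q)),
    mul_nonneg hp.le (sq_nonneg (q - (1 - p - q))), mul_nonneg hq.le (sq_nonneg (p - (1 - p - q))),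
    mul_nonneg hr.le (sq_nonneg (p - q))]

theorem exists_root_le {c z : ℝ} (hz : 0 ≤ z) (h : 2 + c * z ^ 3 ≤ z) :
    ∃ y, 0 < y ∧ y ≤ z ∧ y = 2 + c * y ^ 3 := by
  obtain ⟨y, hy, hy0⟩ := intermediate_value_Icc (f := fun y : ℝ => y - (2 + c * y ^ 3)) hz
    (by fun_prop) (show (0 : ℝ) ∈ _ from ⟨by norm_num, by simpa using h⟩)
  refine ⟨y, hy.1.lt_of_ne ?_, hy.2, by simpa [sub_eq_zero] using hy0⟩
  rintro rfl
  norm_num at hy0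

theorem exists_isLeast_root (hp : 0 < p) (hq : 0 < q) (hr : 0 < r) (hpqr : p + q + r = 1) :
    ∃ w : ℝ, IsLeast {z : ℝ | 0 < z ∧ z = 2 + p * q * r * z ^ 3} w := by
  obtain ⟨y, hy0, hy3, hy⟩ := exists_root_le (c := p * q * r) (z := 3) (by norm_num)
    (by linarith [mul_mul_le_of_add_add_eq_one hp hq hr hpqr])
  -- Since 27pqr ≤ 1, there is a root in [0, 3], and a least root may be sought in this compact
  -- interval.
  have hc : IsCompact {z : ℝ | z ∈ Set.Icc 0 3 ∧ z = 2 + p * q * r * z ^ 3} :=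
    isCompact_Icc.inter_right (isClosed_eq continuous_id (by fun_prop))
  obtain ⟨w, ⟨hw, hw'⟩, hle⟩ := hc.exists_isLeast ⟨y, ⟨hy0.le, hy3⟩, hy⟩
  refine ⟨w, ⟨hw.1.lt_of_ne ?_, hw'⟩, ?_⟩
  · rintro rfl
    norm_num at hw'
  · rintro z ⟨hz, hz'⟩
    rcases le_total z 3 with h | h
    · exact hle ⟨⟨hz.le, h⟩, hz'⟩
    · exact hw.2.trans h

variable (hw : IsLeast {z : ℝ | 0 < z ∧ z = 2 + p * q * r * z ^ 3} w)
include hw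

theorem IsLeast.root_lt {z : ℝ} (hz : 0 ≤ z) (h : 2 + p * q * r * z ^ 3 < z) : w < z := by
  obtain ⟨y, hy0, hyz, hy⟩ := exists_root_le hz h.le
  refine (hw.2 ⟨hy0, hy⟩).trans_lt (hyz.lt_of_ne ?_)
  rintro rfl
  exact h.ne hy.symm

/-- As pqrw³ = w - 2, the claim is equivalent to w < 2/(q + r). The inequality `IsLeast.root_lt`
needs at 2/(q + r) reduces to (q - r)² > 0. -/
theorem IsLeast.mul_mul_sq_lt_one (hp : 0 < p) (hq : 0 < q) (hr : 0 < r) (hpqr : p + q + r = 1)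
    (hqr : r ≠ q) : q * r * w ^ 2 < 1 := by
  have hs : 0 < q + r := by positivity
  have h1 : w < 2 / (q + r) := by
    refine IsLeast.root_lt hw (by positivity) ?_
    have : 2 / (q + r) - (2 + p * q * r * (2 / (q + r)) ^ 3)
        = 2 * p * (q - r) ^ 2 / (q + r) ^ 3 := by
      have : p = 1 - q - r := by linarith
      subst this
      field_simp
      ring
    have h2 : 0 < 2 * p * (q - r) ^ 2 / (q + r) ^ 3 := by
      have := sq_pos_of_ne_zero (sub_ne_zero.2 hqr.symm)
      positivity
    linarith
  rw [lt_div_iff₀ hs] at h1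
  obtain ⟨hw0, hw1⟩ := hw.1
  have h2 : (p * w) * (q * r * w ^ 2) < (p * w) * 1 := by nlinarith
  exact lt_of_mul_lt_mul_left h2 (by positivity)

theorem IsLeast.root_le_three (hp : 0 < p) (hq : 0 < q) (hr : 0 < r) (hpqr : p + q + r = 1) :
    w ≤ 3 := by
  obtain ⟨y, hy0, hy3, hy⟩ := exists_root_le (c := p * q * r) (z := 3) (by norm_num)
    (by linarith [mul_mul_le_of_add_add_eq_one hp hq hr hpqr])
  exact (hw.2 ⟨hy0, hy⟩).trans hy3

theorem IsLeast.swap_root : IsLeast {z : ℝ | 0 < z ∧ z = 2 + q * p * r * z ^ 3} w := by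
  rwa [mul_comm q p]

theorem IsLeast.root_eq_of_eq (hp : 0 < p) (hr : 0 < r) (hpqr : p + q + r = 1) (hpq : p = q)
    (hrp : r < p) : w = 1 / p := by
  subst hpq
  refine le_antisymm (hw.2 ⟨by positivity, ?_⟩) ?_
  · have : r = 1 - p - p := by linarith
    subst this
    field_simp
    ring
  · by_contra! h
    obtain ⟨hw0, hw1⟩ := hw.1
    rw [lt_div_iff₀ hp] at h
    -- The root 1/p is factored out of the cubic. If wp < 1, the cofactor exceeds 2p - 2r > 0, so it
    -- has no zero.
    have h1 : (w * p - 1) * (2 * p - p * r * w - p * r * w * (w * p)) = 0 := by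
      have h2 : 2 * p = 1 - r := by linarith
      linear_combination p * hw1 + p * w * h2
    have h3 : 2 * p - p * r * w - p * r * w * (w * p) = 0 :=
      (mul_eq_zero.1 h1).resolve_left (by linarith : w * p - 1 < 0).ne
    have h4 : p * r * w < r := by nlinarith
    have h5 : p * r * w * (w * p) < r * 1 := by
      apply mul_lt_mul h4 h.le (by positivity) hr.le
    linarith

end Root

/-! ### Principal square roots in the right half plane -/

section Sqrt

theorem Complex.sqrt_sq (z : ℂ) : Complex.sqrt z ^ 2 = z := by
  rw [Complex.sqrt, ← Complex.cpow_nat_mul]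
  norm_num

/-- Both arguments lie in (-π/2, π/2), so half their sum does too. This fixes the sign when a
product of roots is identified from its square. -/
theorem Complex.re_sqrt_mul_sqrt_pos {z z' : ℂ} (hz : 0 < z.re) (hz' : 0 < z'.re) :
    0 < (Complex.sqrt z * Complex.sqrt z').re := by
  have h0 : z ≠ 0 := by rintro rfl; simp at hz
  have h0' : z' ≠ 0 := by rintro rfl; simp at hz'
  rw [Complex.sqrt, Complex.sqrt, Complex.cpow_def_of_ne_zero h0, Complex.cpow_def_of_ne_zero h0',
    ← Complex.exp_add, Complex.exp_re]
  have h1 := abs_lt.1 (Complex.abs_arg_lt_pi_div_two_iff.2 (Or.inl hz))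
  have h2 := abs_lt.1 (Complex.abs_arg_lt_pi_div_two_iff.2 (Or.inl hz'))
  have him : (Complex.log z * 2⁻¹ + Complex.log z' * 2⁻¹).im = (z.arg + z'.arg) / 2 := by
    simp [Complex.log_im]
    ring
  rw [him]
  exact mul_pos (Real.exp_pos _) (Real.cos_pos_of_mem_Ioo ⟨by linarith, by linarith⟩)

theorem Complex.re_sqrt_pos {z : ℂ} (hz : 0 < z.re) : 0 < (Complex.sqrt z).re := by
  simpa using Complex.re_sqrt_mul_sqrt_pos hz (z' := 1) (by simp)

theorem eq_of_sq_eq_sq_of_re_pos {z z' : ℂ} (h : z ^ 2 = z' ^ 2) (hz : 0 < z.re)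
    (hz' : 0 < z'.re) : z = z' := by
  rcases sq_eq_sq_iff_eq_or_eq_neg.1 h with h | h
  · exact h
  · rw [h, Complex.neg_re] at hz
    linarith

end Sqrt

/-! ### Boundary functions and the kernel curve -/

/-- The expression for `Q(x,0) / Q(0,0)`, written without an apparent singularity at `x = p/q`. -/
noncomputable def fhBoundary (p q r w : ℝ) (x : ℂ) : ℂ :=
  (Complex.sqrt (1 - x * q * r * w ^ 2) + x * r * w * (q * w - 1) /
    (Complex.sqrt (1 - x * q * r * w ^ 2) + Complex.sqrt (1 - p * r * w ^ 2))) / (1 - r * x / p)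

section Algebra

variable {p q r w : ℝ} {x y : ℂ}

theorem re_one_sub_pos {z : ℂ} (h : ‖z‖ < 1) : 0 < (1 - z).re := by
  have := (Complex.re_le_norm z).trans_lt h
  simp
  linarith

theorem one_sub_ne_zero_of_norm_lt {z : ℂ} (h : ‖z‖ < 1) : 1 - z ≠ 0 := fun h0 => by
  have := re_one_sub_pos h
  simp [h0] at this

theorem Complex.sqrt_add_sqrt_ne_zero {z z' : ℂ} (hz : 0 < z.re) (hz' : 0 < z'.re) :
    Complex.sqrt z + Complex.sqrt z' ≠ 0 := fun h => by
  have := add_pos (Complex.re_sqrt_pos hz) (Complex.re_sqrt_pos hz')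
  rw [← Complex.add_re, h] at this
  simp at this

theorem fhBoundary_zero : fhBoundary p q r w 0 = 1 := by
  simp [fhBoundary]

theorem mul_fhBoundary (hp : p ≠ 0) (hq : q ≠ 0) (hw : w ≠ 0)
    (hx : 0 < (1 - x * q * r * w ^ 2).re) (hc : 0 < (1 - (p : ℂ) * r * w ^ 2).re)
    (hrx : 1 - r * x / p ≠ 0) :
    (1 - q * x / p) * (1 - r * x / p) * fhBoundary p q r w x
      = (1 - x / (p * w)) * Complex.sqrt (1 - x * q * r * w ^ 2)
        - q * x / p * (1 - 1 / (q * w)) * Complex.sqrt (1 - p * r * w ^ 2) := by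
  have hp' : (p : ℂ) ≠ 0 := mod_cast hp
  have hq' : (q : ℂ) ≠ 0 := mod_cast hq
  have hw' : (w : ℂ) ≠ 0 := mod_cast hw
  have hne := Complex.sqrt_add_sqrt_ne_zero hx hc
  have hu := Complex.sqrt_sq (1 - x * q * r * w ^ 2)
  have hv := Complex.sqrt_sq (1 - (p : ℂ) * r * w ^ 2)
  rw [fhBoundary]
  set u := Complex.sqrt (1 - x * q * r * w ^ 2)
  set v := Complex.sqrt (1 - (p : ℂ) * r * w ^ 2)
  rw [mul_assoc, mul_div_cancel₀ _ hrx]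
  -- Here u² - v² = prw²(1 - qx/p), so the factor 1 - qx/p cancels against u - v.
  have h1 : x * r * w * (q * w - 1) / (u + v) * (1 - q * x / p)
      = q * x / p * (1 - 1 / (q * w)) * (u - v) := by
    rw [div_mul_eq_mul_div, div_eq_iff hne]
    field_simp
    linear_combination x * (w * q - 1) * (hv - hu)
  rw [mul_add, mul_comm _ (_ / (u + v)), h1]
  field_simp
  ring

/-- On the curve `K = 0`, the product of the two square roots is `1 - rwxy`. -/
theorem sqrt_mul_sqrt_eq (hw : w = 2 + p * q * r * w ^ 3)
    (hx : 0 < (1 - x * q * r * w ^ 2).re) (hy : 0 < (1 - y * p * r * w ^ 2).re)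
    (hxy : 0 < (1 - r * w * (x * y)).re)
    (hk : x * y - p * y - q * x - r * x ^ 2 * y ^ 2 = 0) :
    Complex.sqrt (1 - x * q * r * w ^ 2) * Complex.sqrt (1 - y * p * r * w ^ 2)
      = 1 - r * w * (x * y) := by
  have hw' : (w : ℂ) = 2 + p * q * r * w ^ 3 := mod_cast hw
  refine eq_of_sq_eq_sq_of_re_pos ?_ (Complex.re_sqrt_mul_sqrt_pos hx hy) hxy
  rw [mul_pow, Complex.sqrt_sq, Complex.sqrt_sq]
  linear_combination (r * w ^ 2 : ℂ) * hk - (r * w * (x * y) : ℂ) * hw'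

/-- On the curve `K = 0`, `(p/x - 1/w) u + (q/y - 1/w) v = 0`. -/
theorem sqrt_linear_relation (hw : w = 2 + p * q * r * w ^ 3)
    (hx : 0 < (1 - x * q * r * w ^ 2).re) (hy : 0 < (1 - y * p * r * w ^ 2).re)
    (hxy : 0 < (1 - r * w * (x * y)).re)
    (hk : x * y - p * y - q * x - r * x ^ 2 * y ^ 2 = 0) :
    (p * w * y - x * y) * Complex.sqrt (1 - x * q * r * w ^ 2)
      + (q * w * x - x * y) * Complex.sqrt (1 - y * p * r * w ^ 2) = 0 := by
  have hw' : (w : ℂ) = 2 + p * q * r * w ^ 3 := mod_cast hw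
  have hv := Complex.sqrt_sq (1 - y * p * r * w ^ 2)
  have huv := sqrt_mul_sqrt_eq hw hx hy hxy hk
  have hv0 : Complex.sqrt (1 - y * p * r * w ^ 2) ≠ 0 := fun h => by
    have := Complex.re_sqrt_pos hy
    simp [h] at this
  set u := Complex.sqrt (1 - x * q * r * w ^ 2)
  set v := Complex.sqrt (1 - y * p * r * w ^ 2)
  -- Multiplying by v turns uv and v² into polynomials; what remains is a combination of K = 0 and
  -- the cubic for w.
  refine (mul_eq_zero.1 (?_ : _ * v = 0)).resolve_right hv0
  linear_combination (p * w * y - x * y) * huv + (q * w * x - x * y) * hv - w * hk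
    + (x * y) * hw'

theorem norm_mul_mul_lt_one {R : ℝ} (hq : 0 < q) (hr : 0 < r) (hR : R * (q * r * w ^ 2) ≤ 1)
    (hx : ‖x‖ < R) : ‖x * q * r * w ^ 2‖ < 1 := by
  rcases eq_or_ne w 0 with rfl | hw
  · simp
  rw [mul_assoc, mul_assoc, norm_mul]
  have : ‖(q : ℂ) * (r * w ^ 2)‖ = q * r * w ^ 2 := by
    rw [← mul_assoc]
    norm_cast
    exact Real.norm_of_nonneg (by positivity)
  rw [this]
  exact (mul_lt_mul_of_pos_right hx (by positivity)).trans_le hR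

theorem norm_mul_div_lt_one {R : ℝ} (hp : 0 < p) (hr : 0 < r) (hRr : r * R ≤ p) (hx : ‖x‖ < R) :
    ‖r * x / p‖ < 1 := by
  rw [norm_div, norm_mul, Complex.norm_of_nonneg hp.le, Complex.norm_of_nonneg hr.le,
    div_lt_one hp]
  exact (mul_lt_mul_of_pos_left hx hr).trans_le hRr

theorem fhBoundary_vanishing (hp : 0 < p) (hq : 0 < q) (hpqr : p + q + r = 1)
    (hw : w = 2 + p * q * r * w ^ 3) (hw0 : 0 < w)
    (hcp : p * r * w ^ 2 < 1) (hcq : q * r * w ^ 2 < 1) (hrw : r * w < 1)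
    (hx : 0 < (1 - x * q * r * w ^ 2).re) (hy : 0 < (1 - y * p * r * w ^ 2).re)
    (hxy : 0 < (1 - r * w * (x * y)).re)
    (hrx : 1 - r * x / p ≠ 0) (hry : 1 - r * y / q ≠ 0)
    (hpy : 1 - p * y / q ≠ 0)
    (hk : x * y - p * y - q * x - r * x ^ 2 * y ^ 2 = 0) :
    q * x * (y - 1) * fhBoundary p q r w x + p * y * (x - 1) * fhBoundary q p r w y = 0 := by
  have hp' : (p : ℂ) ≠ 0 := mod_cast hp.ne'
  have hq' : (q : ℂ) ≠ 0 := mod_cast hq.ne'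
  have hw'' : (w : ℂ) ≠ 0 := mod_cast hw0.ne'
  have hr : (r : ℂ) = 1 - p - q := by
    rw [← Complex.ofReal_one, ← hpqr]
    push_cast
    ring
  have hcp' : 0 < (1 - (p : ℂ) * r * w ^ 2).re := by
    have : (1 - (p : ℂ) * r * w ^ 2) = ((1 - p * r * w ^ 2 : ℝ) : ℂ) := by push_cast; ring
    rw [this, Complex.ofReal_re]
    linarith
  have hcq' : 0 < (1 - (q : ℂ) * r * w ^ 2).re := by
    have : (1 - (q : ℂ) * r * w ^ 2) = ((1 - q * r * w ^ 2 : ℝ) : ℂ) := by push_cast; ring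
    rw [this, Complex.ofReal_re]
    linarith
  have hrw' : 0 < (1 - (r : ℂ) * w * (1 * 1)).re := by
    have : (1 - (r : ℂ) * w * (1 * 1)) = ((1 - r * w : ℝ) : ℂ) := by push_cast; ring
    rw [this, Complex.ofReal_re]
    linarith
  have hF := mul_fhBoundary hp.ne' hq.ne' hw0.ne' hx hcp' hrx
  have hG := mul_fhBoundary (p := q) (q := p) hq.ne' hp.ne' hw0.ne' hy hcq' hry
  have hrel := sqrt_linear_relation hw hx hy hxy hk
  -- The point (1, 1) lies on K = 0 because p + q + r = 1; the relation there cancels the constant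
  -- terms c and d.
  have hrel1 := sqrt_linear_relation (x := 1) (y := 1) hw (by simpa using hcq')
    (by simpa using hcp') hrw' (by rw [hr]; ring)
  simp only [one_mul, mul_one] at hrel1
  set f := fhBoundary p q r w x
  set g := fhBoundary q p r w y
  set u := Complex.sqrt (1 - x * q * r * w ^ 2)
  set v := Complex.sqrt (1 - y * p * r * w ^ 2)
  set c := Complex.sqrt (1 - (p : ℂ) * r * w ^ 2)
  set d := Complex.sqrt (1 - (q : ℂ) * r * w ^ 2)
  have hFG : p * y * ((1 - q * x / p) * (1 - r * x / p) * f)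
      + q * x * ((1 - p * y / q) * (1 - r * y / q) * g) = 0 := by
    rw [hF, hG]
    field_simp
    linear_combination hrel - x * y * hrel1
  -- The difference of the two sides is (qx - py)K times a polynomial identity constant. Combined
  -- with `hFG`, it turns the relation between f and g into the required one, up to a nonzero
  -- factor.
  have hR : x ^ 2 * (y - 1) * ((1 - p * y / q) * (1 - r * y / q)) * q ^ 2
      = y ^ 2 * (x - 1) * ((1 - q * x / p) * (1 - r * x / p)) * p ^ 2 := by
    have h1 : (1 - p * y / q) * (1 - r * y / q) * q ^ 2 = (q - p * y) * (q - r * y) := by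
      field_simp
    have h2 : (1 - q * x / p) * (1 - r * x / p) * p ^ 2 = (p - q * x) * (p - r * x) := by
      field_simp
    rw [mul_assoc, h1, mul_assoc _ (_ * _) (_ ^ 2), h2]
    rw [hr] at hk ⊢
    linear_combination (q * x - p * y) * hk
  by_cases hx0 : x = 0
  · subst hx0
    have : y = 0 := by simpa [hp'] using hk
    simp [this]
  refine (mul_eq_zero.1 (?_ : x * q * ((1 - p * y / q) * (1 - r * y / q)) * _ = 0)).resolve_left
    (mul_ne_zero (mul_ne_zero hx0 hq') (mul_ne_zero hpy hry))
  linear_combination f * hR + p * y * (x - 1) * hFG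

theorem differentiableOn_fhBoundary {R : ℝ} (hp : 0 < p) (hq : 0 < q) (hr : 0 < r)
    (hcp : p * r * w ^ 2 < 1) (hR : R * (q * r * w ^ 2) ≤ 1) (hRr : r * R ≤ p) :
    DifferentiableOn ℂ (fhBoundary p q r w) (Metric.ball 0 R) := by
  intro x hx
  rw [mem_ball_zero_iff] at hx
  have hre := re_one_sub_pos (norm_mul_mul_lt_one hq hr hR hx)
  have hcp' : 0 < (1 - (p : ℂ) * r * w ^ 2).re := by
    have : (1 - (p : ℂ) * r * w ^ 2) = ((1 - p * r * w ^ 2 : ℝ) : ℂ) := by push_cast; ring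
    rw [this, Complex.ofReal_re]
    linarith
  have hsq : DifferentiableAt ℂ (fun x : ℂ => Complex.sqrt (1 - x * q * r * w ^ 2)) x :=
    (Complex.differentiableAt_sqrt (Or.inl hre)).comp (f := fun x : ℂ => 1 - x * q * r * w ^ 2) x
      (by fun_prop)
  have hrx := one_sub_ne_zero_of_norm_lt (norm_mul_div_lt_one hp hr hRr hx)
  have hnum : DifferentiableAt ℂ (fun x : ℂ => x * r * w * (q * w - 1)) x := by fun_prop
  have hden : DifferentiableAt ℂ (fun x : ℂ => 1 - r * x / p) x := by fun_prop
  exact ((hsq.add (hnum.div (hsq.add_const _)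
    (Complex.sqrt_add_sqrt_ne_zero hre hcp'))).div hden hrx).differentiableWithinAt

end Algebra

/-! ### Laurent coefficients on circles and tori -/

section Torus

open MeasureTheory Metric Set

/-- The coefficient of `z ^ m` in the Laurent expansion of `f` on the circle of radius `ρ`. -/
noncomputable def laurentCoeff (ρ : ℝ) (f : ℂ → ℂ) (m : ℤ) : ℂ :=
  (2 * Real.pi : ℂ)⁻¹ * ∫ θ in (0)..2 * Real.pi, f (circleMap 0 ρ θ) * circleMap 0 ρ θ ^ (-m)

/-- The coefficient of `x ^ m * y ^ n` in the Laurent expansion of `H` on the torus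
`‖x‖ = ‖y‖ = ρ`. -/
noncomputable def torusCoeff (ρ : ℝ) (H : ℂ → ℂ → ℂ) (m n : ℤ) : ℂ :=
  (2 * Real.pi : ℂ)⁻¹ * (2 * Real.pi : ℂ)⁻¹ *
    ∫ t in Icc (0 : ℝ) (2 * Real.pi) ×ˢ Icc (0 : ℝ) (2 * Real.pi),
      H (circleMap 0 ρ t.1) (circleMap 0 ρ t.2) *
        (circleMap 0 ρ t.1 ^ (-m) * circleMap 0 ρ t.2 ^ (-n))

section LaurentCoeff

variable {ρ : ℝ} {f g : ℂ → ℂ}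

theorem laurentCoeff_congr (hρ : 0 ≤ ρ) (h : EqOn f g (sphere 0 ρ)) (m : ℤ) :
    laurentCoeff ρ f m = laurentCoeff ρ g m := by
  simp only [laurentCoeff]
  congr 2
  ext θ
  rw [h (circleMap_mem_sphere 0 hρ θ)]

theorem laurentCoeff_eq_circleIntegral (hρ : 0 < ρ) (m : ℤ) :
    laurentCoeff ρ f m
      = (2 * Real.pi * Complex.I : ℂ)⁻¹ * ∮ z in C(0, ρ), z ^ (-m - 1) * f z := by
  have : ∀ θ, deriv (circleMap 0 ρ) θ • (circleMap 0 ρ θ ^ (-m - 1) * f (circleMap 0 ρ θ))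
      = Complex.I * (f (circleMap 0 ρ θ) * circleMap 0 ρ θ ^ (-m)) := fun θ => by
    have hne : circleMap 0 ρ θ ≠ 0 := circleMap_ne_center hρ.ne'
    rw [deriv_circleMap, smul_eq_mul, zpow_sub_one₀ hne]
    field_simp
  rw [laurentCoeff, circleIntegral]
  simp only [this]
  rw [intervalIntegral.integral_const_mul, ← mul_assoc]
  congr 1
  have := Complex.I_ne_zero
  field_simp

theorem laurentCoeff_eq_zero (hρ : 0 < ρ) (hf : DiffContOnCl ℂ f (ball 0 ρ)) {m : ℤ} (hm : m < 0) :
    laurentCoeff ρ f m = 0 := by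
  obtain ⟨k, hk⟩ := Int.eq_ofNat_of_zero_le (show 0 ≤ -m - 1 by omega)
  rw [laurentCoeff_eq_circleIntegral hρ, hk]
  simp only [zpow_natCast]
  have : DiffContOnCl ℂ (fun z : ℂ => z ^ k * f z) (ball 0 ρ) :=
    (show Differentiable ℂ (fun z : ℂ => z ^ k) by fun_prop).diffContOnCl.smul hf
  rw [this.circleIntegral_eq_zero hρ.le, mul_zero]

theorem hasSum_laurentCoeff (hρ : 0 < ρ) (hf : DiffContOnCl ℂ f (ball 0 ρ)) {x : ℂ}
    (hx : ‖x‖ < ρ) : HasSum (fun n : ℕ => laurentCoeff ρ f n * x ^ n) (f x) := by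
  have h1 := hasSum_cauchyPowerSeries_integral (c := 0) (w := x)
    (hf.continuousOn_ball.mono sphere_subset_closedBall |>.circleIntegrable hρ.le) hx
  rw [zero_add, hf.two_pi_i_inv_smul_circleIntegral_sub_inv_smul (by simpa using hx)] at h1
  refine h1.congr_fun fun n => ?_
  rw [cauchyPowerSeries_apply, laurentCoeff_eq_circleIntegral hρ, smul_eq_mul, mul_assoc,
    mul_comm (∮ z in C(0, ρ), _), ← circleIntegral.integral_const_mul]
  congr 1
  refine circleIntegral.integral_congr hρ.le fun z hz => ?_
  have hz0 : z ≠ 0 := by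
    rintro rfl
    simp at hz
    exact hρ.ne hz
  simp only [sub_zero, smul_eq_mul, div_pow]
  rw [show (-(n : ℤ) - 1) = -((n + 1 : ℕ) : ℤ) by push_cast; ring, zpow_neg, zpow_natCast]
  field_simp
  ring

theorem laurentCoeff_one (hρ : 0 < ρ) (m : ℤ) :
    laurentCoeff ρ (fun _ => 1) m = if m = 0 then 1 else 0 := by
  have h1 : laurentCoeff ρ (fun _ => 1) m
      = (2 * Real.pi * Complex.I : ℂ)⁻¹ * ∮ z in C(0, ρ), (z - 0) ^ (-m - 1) := by
    rw [laurentCoeff_eq_circleIntegral hρ]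
    simp
  rw [h1]
  split_ifs with hm
  · subst hm
    simp only [neg_zero, zero_sub, zpow_neg_one]
    rw [circleIntegral.integral_sub_center_inv 0 hρ.ne', inv_mul_cancel₀ Complex.two_pi_I_ne_zero]
  · rw [circleIntegral.integral_sub_zpow_of_ne (by omega), mul_zero]

/-- The product of the roots has modulus ‖γ‖/‖α‖ > ρ², so at most one root lies in the disc. It is a
zero of g, hence the quotient extends holomorphically and Cauchy's theorem applies. -/
theorem laurentCoeff_div_quadratic {R : ℝ} (hρ : 0 < ρ) (hR : ρ < R)
    (hg : DifferentiableOn ℂ g (ball 0 R)) {α β γ : ℂ} (hα : α ≠ 0) (hγ : ρ ^ 2 * ‖α‖ < ‖γ‖)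
    (hne : ∀ z ∈ sphere (0 : ℂ) ρ, α * z ^ 2 + β * z + γ ≠ 0)
    (hz : ∀ z : ℂ, ‖z‖ < ρ → α * z ^ 2 + β * z + γ = 0 → g z = 0) {m : ℤ} (hm : m < 0) :
    laurentCoeff ρ (fun z => g z / (α * z ^ 2 + β * z + γ)) m = 0 := by
  obtain ⟨s, hs⟩ : ∃ s : ℂ, s ^ 2 = β ^ 2 - 4 * α * γ := ⟨_, Complex.sqrt_sq _⟩
  have hfac : ∃ a b : ℂ, (∀ z, α * z ^ 2 + β * z + γ = α * ((z - a) * (z - b))) ∧ ρ < ‖b‖ := by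
    have h1 : ∀ z, α * z ^ 2 + β * z + γ
        = α * ((z - (-β + s) / (2 * α)) * (z - (-β - s) / (2 * α))) := fun z => by
      field_simp
      linear_combination hs
    by_cases hb : ρ < ‖(-β - s) / (2 * α)‖
    · exact ⟨_, _, h1, hb⟩
    -- If this root is not outside the circle, the product of the roots forces the other one to be,
    -- and the names are exchanged.
    · refine ⟨(-β - s) / (2 * α), (-β + s) / (2 * α), fun z => (h1 z).trans (by ring), ?_⟩
      have h2 : γ = α * ((-β + s) / (2 * α) * ((-β - s) / (2 * α))) := by
        have := h1 0
        simpa using this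
      rw [h2, norm_mul, norm_mul, mul_comm, mul_lt_mul_iff_right₀ (norm_pos_iff.2 hα)] at hγ
      by_contra! h3
      have := mul_le_mul h3 (not_lt.1 hb) (norm_nonneg _) hρ.le
      nlinarith
  obtain ⟨a, b, hab, hb⟩ := hfac
  have hbne : ∀ z : ℂ, z ∈ closedBall 0 ρ → z - b ≠ 0 := fun z hz h => by
    rw [sub_eq_zero.1 h, mem_closedBall_zero_iff] at hz
    linarith
  have hsub : closedBall (0 : ℂ) ρ ⊆ ball 0 R := closedBall_subset_ball hR
  have hana : a ∉ sphere (0 : ℂ) ρ := fun h => hne a h (by rw [hab]; simp)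
  by_cases ha : ‖a‖ < ρ
  · have hga : g a = 0 := hz a ha (by rw [hab]; simp)
    have hd : DifferentiableOn ℂ (dslope g a) (ball 0 R) :=
      (Complex.differentiableOn_dslope (isOpen_ball.mem_nhds (by simp; linarith))).2 hg
    have he : DiffContOnCl ℂ (fun z => dslope g a z / (α * (z - b))) (ball 0 ρ) := by
      apply DifferentiableOn.diffContOnCl
      rw [closure_ball _ hρ.ne']
      exact (hd.mono hsub).div (by fun_prop) fun z hz => mul_ne_zero hα (hbne z hz)
    rw [← laurentCoeff_eq_zero hρ he hm]
    refine laurentCoeff_congr hρ.le (fun z hz => ?_) m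
    have hza : z ≠ a := fun h => hana (h ▸ hz)
    have h1 := hbne z (sphere_subset_closedBall hz)
    have h2 := sub_ne_zero.2 hza
    simp only [hab]
    rw [dslope_of_ne _ hza, slope_def_field, hga]
    field_simp
    ring
  · have he : DiffContOnCl ℂ (fun z => g z / (α * z ^ 2 + β * z + γ)) (ball 0 ρ) := by
      apply DifferentiableOn.diffContOnCl
      rw [closure_ball _ hρ.ne']
      refine (hg.mono hsub).div (by fun_prop) fun z hz => ?_
      rw [hab]
      refine mul_ne_zero hα (mul_ne_zero (fun h => ?_) (hbne z hz))
      rw [sub_eq_zero.1 h, mem_closedBall_zero_iff] at hz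
      exact hana (by simpa using le_antisymm hz (not_lt.1 ha))
    exact laurentCoeff_eq_zero hρ he hm

end LaurentCoeff

section TorusCoeff

variable {ρ : ℝ} {H H' : ℂ → ℂ → ℂ} {f g : ℂ → ℂ}

theorem integral_Icc_mul_zpow_circleMap (f : ℂ → ℂ) (m : ℤ) :
    (2 * Real.pi : ℂ)⁻¹ * ∫ θ in Icc (0 : ℝ) (2 * Real.pi),
      f (circleMap 0 ρ θ) * circleMap 0 ρ θ ^ (-m) = laurentCoeff ρ f m := by
  rw [laurentCoeff, intervalIntegral.integral_of_le Real.two_pi_pos.le, integral_Icc_eq_integral_Ioc]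

theorem torusCoeff_congr (hρ : 0 ≤ ρ)
    (h : ∀ x ∈ sphere (0 : ℂ) ρ, ∀ y ∈ sphere (0 : ℂ) ρ, H x y = H' x y) (m n : ℤ) :
    torusCoeff ρ H m n = torusCoeff ρ H' m n := by
  simp only [torusCoeff]
  congr 2
  ext t
  rw [h _ (circleMap_mem_sphere 0 hρ _) _ (circleMap_mem_sphere 0 hρ _)]

theorem torusCoeff_mul (f g : ℂ → ℂ) (m n : ℤ) :
    torusCoeff ρ (fun x y => f x * g y) m n = laurentCoeff ρ f m * laurentCoeff ρ g n := by
  rw [← integral_Icc_mul_zpow_circleMap, ← integral_Icc_mul_zpow_circleMap, torusCoeff,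
    mul_mul_mul_comm, ← setIntegral_prod_mul, Measure.volume_eq_prod]
  congr 2
  ext t
  ring

theorem torusCoeff_swap (m n : ℤ) :
    torusCoeff ρ (fun x y => H y x) m n = torusCoeff ρ H n m := by
  rw [torusCoeff, torusCoeff, Measure.volume_eq_prod, ← setIntegral_prod_swap]
  congr 2
  ext t
  simp [mul_comm]

theorem continuous_torus_integrand (hρ : 0 < ρ)
    (hH : Continuous fun t : ℝ × ℝ => H (circleMap 0 ρ t.1) (circleMap 0 ρ t.2)) (m n : ℤ) :
    Continuous fun t : ℝ × ℝ => H (circleMap 0 ρ t.1) (circleMap 0 ρ t.2) *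
        (circleMap 0 ρ t.1 ^ (-m) * circleMap 0 ρ t.2 ^ (-n)) := by
  have hc := continuous_circleMap 0 ρ
  refine hH.mul (Continuous.mul ?_ ?_)
  · exact (hc.comp continuous_fst).zpow₀ _ fun t => Or.inl (circleMap_ne_center hρ.ne')
  · exact (hc.comp continuous_snd).zpow₀ _ fun t => Or.inl (circleMap_ne_center hρ.ne')

theorem integrableOn_torus_integrand (hρ : 0 < ρ)
    (hH : Continuous fun t : ℝ × ℝ => H (circleMap 0 ρ t.1) (circleMap 0 ρ t.2)) (m n : ℤ) :
    IntegrableOn (fun t : ℝ × ℝ => H (circleMap 0 ρ t.1) (circleMap 0 ρ t.2) *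
        (circleMap 0 ρ t.1 ^ (-m) * circleMap 0 ρ t.2 ^ (-n)))
      (Icc (0 : ℝ) (2 * Real.pi) ×ˢ Icc (0 : ℝ) (2 * Real.pi)) :=
  (continuous_torus_integrand hρ hH m n).continuousOn.integrableOn_compact
    (isCompact_Icc.prod isCompact_Icc)

/-- By Fubini, the inner integral over y is already zero for each x on the circle. -/
theorem torusCoeff_eq_zero (hρ : 0 < ρ)
    (hH : Continuous fun t : ℝ × ℝ => H (circleMap 0 ρ t.1) (circleMap 0 ρ t.2)) {n : ℤ}
    (h : ∀ x ∈ sphere (0 : ℂ) ρ, laurentCoeff ρ (H x) n = 0) (m : ℤ) :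
    torusCoeff ρ H m n = 0 := by
  rw [torusCoeff, Measure.volume_eq_prod, setIntegral_prod]
  · rw [integral_eq_zero_of_ae, mul_zero]
    refine Filter.Eventually.of_forall fun θ => ?_
    have h1 := h _ (circleMap_mem_sphere 0 hρ.le θ)
    rw [← integral_Icc_mul_zpow_circleMap, mul_eq_zero] at h1
    have h2 := h1.resolve_left (by simp [Real.pi_ne_zero])
    simp only [Pi.zero_apply]
    simp only [mul_left_comm _ (circleMap 0 ρ θ ^ (-m))]
    rw [integral_const_mul, h2, mul_zero]
  · exact integrableOn_torus_integrand hρ hH m n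

theorem torusCoeff_sub (hρ : 0 < ρ)
    (hH : Continuous fun t : ℝ × ℝ => H (circleMap 0 ρ t.1) (circleMap 0 ρ t.2))
    (hH' : Continuous fun t : ℝ × ℝ => H' (circleMap 0 ρ t.1) (circleMap 0 ρ t.2)) (m n : ℤ) :
    torusCoeff ρ (fun x y => H x y - H' x y) m n = torusCoeff ρ H m n - torusCoeff ρ H' m n := by
  rw [torusCoeff, torusCoeff, torusCoeff, ← mul_sub, ← integral_sub
    (integrableOn_torus_integrand hρ hH m n) (integrableOn_torus_integrand hρ hH' m n)]
  simp only [sub_mul]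

theorem torusCoeff_add (hρ : 0 < ρ)
    (hH : Continuous fun t : ℝ × ℝ => H (circleMap 0 ρ t.1) (circleMap 0 ρ t.2))
    (hH' : Continuous fun t : ℝ × ℝ => H' (circleMap 0 ρ t.1) (circleMap 0 ρ t.2)) (m n : ℤ) :
    torusCoeff ρ (fun x y => H x y + H' x y) m n = torusCoeff ρ H m n + torusCoeff ρ H' m n := by
  rw [torusCoeff, torusCoeff, torusCoeff, ← mul_add, ← integral_add
    (integrableOn_torus_integrand hρ hH m n) (integrableOn_torus_integrand hρ hH' m n)]
  simp only [add_mul]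

theorem torusCoeff_monomial_mul (hρ : 0 < ρ) (c : ℂ) (i j m n : ℤ) :
    torusCoeff ρ (fun x y => c * x ^ i * y ^ j * H x y) m n
      = c * torusCoeff ρ H (m - i) (n - j) := by
  rw [torusCoeff, torusCoeff, mul_left_comm c, ← integral_const_mul c]
  congr 2
  ext t
  have h1 : circleMap 0 ρ t.1 ≠ 0 := circleMap_ne_center hρ.ne'
  have h2 : circleMap 0 ρ t.2 ≠ 0 := circleMap_ne_center hρ.ne'
  rw [show -(m - i) = -m + i by ring, show -(n - j) = -n + j by ring, zpow_add₀ h1, zpow_add₀ h2]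
  ring

theorem norm_torusCoeff_le (hρ : 0 < ρ) {M : ℝ}
    (h : ∀ x ∈ sphere (0 : ℂ) ρ, ∀ y ∈ sphere (0 : ℂ) ρ, ‖H x y‖ ≤ M) (m n : ℤ) :
    ‖torusCoeff ρ H m n‖ ≤ M * (ρ ^ (-m) * ρ ^ (-n)) := by
  have hπ := Real.two_pi_pos
  have hvol : (volume : Measure (ℝ × ℝ)).real
      (Icc (0 : ℝ) (2 * Real.pi) ×ˢ Icc (0 : ℝ) (2 * Real.pi)) = (2 * Real.pi) * (2 * Real.pi) := by
    rw [Measure.volume_eq_prod, measureReal_prod_prod]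
    simp [hπ.le]
  have h1 := norm_setIntegral_le_of_norm_le_const (μ := (volume : Measure (ℝ × ℝ)))
    (s := Icc (0 : ℝ) (2 * Real.pi) ×ˢ Icc (0 : ℝ) (2 * Real.pi))
    (f := fun t => H (circleMap 0 ρ t.1) (circleMap 0 ρ t.2) *
        (circleMap 0 ρ t.1 ^ (-m) * circleMap 0 ρ t.2 ^ (-n)))
    (C := M * (ρ ^ (-m) * ρ ^ (-n))) (isCompact_Icc.prod isCompact_Icc).measure_lt_top
    fun t _ => by
      rw [norm_mul, norm_mul, norm_zpow, norm_zpow, norm_circleMap_zero, norm_circleMap_zero,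
        abs_of_pos hρ]
      exact mul_le_mul_of_nonneg_right (h _ (circleMap_mem_sphere 0 hρ.le _) _
        (circleMap_mem_sphere 0 hρ.le _)) (by positivity)
  rw [hvol] at h1
  have hc : ‖(2 * Real.pi : ℂ)⁻¹‖ = (2 * Real.pi)⁻¹ := by
    rw [norm_inv]
    norm_cast
    rw [Real.norm_of_nonneg (by positivity)]
  rw [torusCoeff, norm_mul, norm_mul, hc]
  calc _ ≤ (2 * Real.pi)⁻¹ * (2 * Real.pi)⁻¹ *
        (M * (ρ ^ (-m) * ρ ^ (-n)) * (2 * Real.pi * (2 * Real.pi))) := by gcongr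
    _ = _ := by field_simp

end TorusCoeff

/-! ### Division by the kernel -/

/-- The quotient of `q x (y - 1) f(x) + p y (x - 1) g(y)` by `x y` times the kernel. -/
noncomputable def fhQuotient (p q r : ℝ) (f g : ℂ → ℂ) (x y : ℂ) : ℂ :=
  (q * x * (y - 1) * f x + p * y * (x - 1) * g y) / (x * y - p * y - q * x - r * x ^ 2 * y ^ 2)

section Division

variable {p q r ρ R : ℝ} {f g : ℂ → ℂ}

/-- On the torus the term xy, of modulus ρ², dominates the others, bounded by (p + q)ρ + rρ⁴. -/
theorem kernel_ne_zero_on_torus (hp : 0 < p) (hq : 0 < q) (hr : 0 < r) (hρ : 0 < ρ)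
    (hK : p + q + r * ρ ^ 3 < ρ) {x y : ℂ} (hx : x ∈ sphere (0 : ℂ) ρ)
    (hy : y ∈ sphere (0 : ℂ) ρ) : x * y - p * y - q * x - r * x ^ 2 * y ^ 2 ≠ 0 := by
  intro h
  rw [mem_sphere_zero_iff_norm] at hx hy
  have h1 : x * y = p * y + q * x + r * x ^ 2 * y ^ 2 := by linear_combination h
  have h2 := congrArg norm h1
  have h3 : ‖p * y + q * x + r * x ^ 2 * y ^ 2‖ ≤ p * ρ + q * ρ + r * ρ ^ 2 * ρ ^ 2 := by
    refine (norm_add₃_le ..).trans (le_of_eq ?_)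
    simp only [norm_mul, norm_pow, Complex.norm_of_nonneg hp.le, Complex.norm_of_nonneg hq.le,
      Complex.norm_of_nonneg hr.le, hx, hy]
  rw [← h2, norm_mul, hx, hy] at h3
  nlinarith

/-- For fixed x the kernel is quadratic in y with product of roots of modulus q/(rρ), which exceeds
ρ² by `hrq`. -/
theorem torusCoeff_fhQuotient_eq_zero_of_snd_neg (hp : 0 < p) (hq : 0 < q) (hr : 0 < r)
    (hρ : 0 < ρ) (hR : ρ < R) (hK : p + q + r * ρ ^ 3 < ρ) (hrq : r * ρ ^ 3 < q)
    (hg : DifferentiableOn ℂ g (ball 0 R))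
    (hcont : Continuous fun t : ℝ × ℝ =>
      fhQuotient p q r f g (circleMap 0 ρ t.1) (circleMap 0 ρ t.2))
    (hv : ∀ x y : ℂ, ‖x‖ = ρ → ‖y‖ < ρ → x * y - p * y - q * x - r * x ^ 2 * y ^ 2 = 0 →
      q * x * (y - 1) * f x + p * y * (x - 1) * g y = 0) (m : ℤ) {n : ℤ} (hn : n < 0) :
    torusCoeff ρ (fhQuotient p q r f g) m n = 0 := by
  refine torusCoeff_eq_zero hρ hcont (fun x hx => ?_) m
  have hx' : ‖x‖ = ρ := mem_sphere_zero_iff_norm.1 hx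
  have hx0 : x ≠ 0 := norm_pos_iff.1 (hx' ▸ hρ)
  have hk : ∀ y, -(r * x ^ 2) * y ^ 2 + (x - p) * y + -(q * x)
      = x * y - p * y - q * x - r * x ^ 2 * y ^ 2 := fun y => by ring
  have h := laurentCoeff_div_quadratic (g := fun y => q * x * (y - 1) * f x + p * y * (x - 1) * g y)
    (α := -(r * x ^ 2)) (β := x - p) (γ := -(q * x)) hρ hR
    (((show Differentiable ℂ fun y : ℂ => q * x * (y - 1) * f x by fun_prop).differentiableOn).add
      ((show Differentiable ℂ fun y : ℂ => p * y * (x - 1) by fun_prop).differentiableOn.mul hg))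
    (neg_ne_zero.2 (mul_ne_zero (mod_cast hr.ne') (pow_ne_zero 2 hx0)))
    (by
      rw [norm_neg, norm_neg, norm_mul, norm_mul, norm_pow, Complex.norm_of_nonneg hr.le,
        Complex.norm_of_nonneg hq.le, hx']
      nlinarith)
    (fun y hy => by rw [hk]; exact kernel_ne_zero_on_torus hp hq hr hρ hK hx hy)
    (fun y hy h => hv x y hx' hy (by rwa [hk] at h)) hn
  simp only [hk] at h
  exact h

theorem fhQuotient_swap (x y : ℂ) : fhQuotient q p r g f y x = fhQuotient p q r f g x y := by
  simp only [fhQuotient]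
  congr 1 <;> ring

theorem torusCoeff_fhQuotient_eq_zero_of_fst_neg (hp : 0 < p) (hq : 0 < q) (hr : 0 < r)
    (hρ : 0 < ρ) (hR : ρ < R) (hK : p + q + r * ρ ^ 3 < ρ) (hrp : r * ρ ^ 3 < p)
    (hf : DifferentiableOn ℂ f (ball 0 R))
    (hcont : Continuous fun t : ℝ × ℝ =>
      fhQuotient p q r f g (circleMap 0 ρ t.1) (circleMap 0 ρ t.2))
    (hv : ∀ x y : ℂ, ‖x‖ < ρ → ‖y‖ = ρ → x * y - p * y - q * x - r * x ^ 2 * y ^ 2 = 0 →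
      q * x * (y - 1) * f x + p * y * (x - 1) * g y = 0) {m : ℤ} (hm : m < 0) (n : ℤ) :
    torusCoeff ρ (fhQuotient p q r f g) m n = 0 := by
  have hswap : fhQuotient q p r g f = fun x y => fhQuotient p q r f g y x := by
    ext x y
    exact fhQuotient_swap y x
  have hcont' : Continuous fun t : ℝ × ℝ =>
      fhQuotient q p r g f (circleMap 0 ρ t.1) (circleMap 0 ρ t.2) := by
    have h0 := hcont.comp (continuous_swap (X := ℝ) (Y := ℝ))
    refine h0.congr fun t => ?_
    simp only [Function.comp_apply, Prod.fst_swap, Prod.snd_swap]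
    rw [← fhQuotient_swap]
  have hv' : ∀ x y : ℂ, ‖x‖ = ρ → ‖y‖ < ρ → x * y - q * y - p * x - r * x ^ 2 * y ^ 2 = 0 →
      p * x * (y - 1) * g x + q * y * (x - 1) * f y = 0 := fun x y hx hy hk => by
    rw [← hv y x hy hx (by linear_combination hk)]
    ring
  have h := torusCoeff_fhQuotient_eq_zero_of_snd_neg (p := q) (q := p) hq hp hr hρ hR
    (by linarith) hrp hf hcont' hv' n hm
  rwa [hswap, torusCoeff_swap] at h

theorem continuousOn_fhQuotient (hp : 0 < p) (hq : 0 < q) (hr : 0 < r) (hρ : 0 < ρ) (hR : ρ < R)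
    (hK : p + q + r * ρ ^ 3 < ρ) (hf : DifferentiableOn ℂ f (ball 0 R))
    (hg : DifferentiableOn ℂ g (ball 0 R)) :
    ContinuousOn (fun z : ℂ × ℂ => fhQuotient p q r f g z.1 z.2)
      (sphere (0 : ℂ) ρ ×ˢ sphere (0 : ℂ) ρ) := by
  have hsub : sphere (0 : ℂ) ρ ⊆ ball 0 R :=
    sphere_subset_closedBall.trans (closedBall_subset_ball hR)
  have hf' : ContinuousOn (fun z : ℂ × ℂ => f z.1) (sphere (0 : ℂ) ρ ×ˢ sphere (0 : ℂ) ρ) :=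
    (hf.continuousOn.mono hsub).comp continuousOn_fst fun z hz => hz.1
  have hg' : ContinuousOn (fun z : ℂ × ℂ => g z.2) (sphere (0 : ℂ) ρ ×ˢ sphere (0 : ℂ) ρ) :=
    (hg.continuousOn.mono hsub).comp continuousOn_snd fun z hz => hz.2
  refine ContinuousOn.div ?_ (by fun_prop) fun z hz =>
    kernel_ne_zero_on_torus hp hq hr hρ hK hz.1 hz.2
  exact ((by fun_prop : ContinuousOn (fun z : ℂ × ℂ => q * z.1 * (z.2 - 1)) _).mul hf').add
    ((by fun_prop : ContinuousOn (fun z : ℂ × ℂ => p * z.2 * (z.1 - 1)) _).mul hg')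

theorem torusCoeff_fhQuotient_recurrence (hp : 0 < p) (hq : 0 < q) (hr : 0 < r) (hρ : 0 < ρ)
    (hR : ρ < R) (hK : p + q + r * ρ ^ 3 < ρ) (hf : DifferentiableOn ℂ f (ball 0 R))
    (hg : DifferentiableOn ℂ g (ball 0 R))
    (hcont : Continuous fun t : ℝ × ℝ =>
      fhQuotient p q r f g (circleMap 0 ρ t.1) (circleMap 0 ρ t.2)) (m n : ℤ) :
    torusCoeff ρ (fhQuotient p q r f g) m n
        - r * torusCoeff ρ (fhQuotient p q r f g) (m - 1) (n - 1)
        - p * torusCoeff ρ (fhQuotient p q r f g) (m + 1) n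
        - q * torusCoeff ρ (fhQuotient p q r f g) m (n + 1)
      = q * laurentCoeff ρ f m * ((if n = 0 then 1 else 0) - (if n + 1 = 0 then 1 else 0))
        + p * laurentCoeff ρ g n * ((if m = 0 then 1 else 0) - (if m + 1 = 0 then 1 else 0)) := by
  set H := fhQuotient p q r f g with hH
  have hsub : sphere (0 : ℂ) ρ ⊆ ball 0 R :=
    sphere_subset_closedBall.trans (closedBall_subset_ball hR)
  have hc := continuous_circleMap 0 ρ
  have cx : ∀ i : ℤ, Continuous fun t : ℝ × ℝ => circleMap 0 ρ t.1 ^ i := fun i =>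
    (hc.comp continuous_fst).zpow₀ _ fun t => Or.inl (circleMap_ne_center hρ.ne')
  have cy : ∀ i : ℤ, Continuous fun t : ℝ × ℝ => circleMap 0 ρ t.2 ^ i := fun i =>
    (hc.comp continuous_snd).zpow₀ _ fun t => Or.inl (circleMap_ne_center hρ.ne')
  have cmon : ∀ {G : ℂ → ℂ → ℂ} (c : ℂ) (i j : ℤ),
      (Continuous fun t : ℝ × ℝ => G (circleMap 0 ρ t.1) (circleMap 0 ρ t.2)) →
      Continuous fun t : ℝ × ℝ => c * circleMap 0 ρ t.1 ^ i * circleMap 0 ρ t.2 ^ j *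
        G (circleMap 0 ρ t.1) (circleMap 0 ρ t.2) := fun c i j hG =>
    ((continuous_const.mul (cx i)).mul (cy j)).mul hG
  have cf : Continuous fun t : ℝ × ℝ => f (circleMap 0 ρ t.1) * 1 :=
    (((hf.continuousOn.mono hsub).comp_continuous (hc.comp continuous_fst)
      fun t => circleMap_mem_sphere 0 hρ.le _)).mul continuous_const
  have cg : Continuous fun t : ℝ × ℝ => 1 * g (circleMap 0 ρ t.2) :=
    continuous_const.mul ((hg.continuousOn.mono hsub).comp_continuous (hc.comp continuous_snd)
      fun t => circleMap_mem_sphere 0 hρ.le _)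
  -- This is (E) on the torus, with every term a monomial times a function so that it only shifts
  -- coefficients. The factors 1 present f and g as products of one-variable functions.
  have h := torusCoeff_congr (m := m) (n := n) hρ.le
    (H := fun x y => H x y - r * x ^ (1 : ℤ) * y ^ (1 : ℤ) * H x y
      - p * x ^ (-1 : ℤ) * y ^ (0 : ℤ) * H x y - q * x ^ (0 : ℤ) * y ^ (-1 : ℤ) * H x y)
    (H' := fun x y => (q * x ^ (0 : ℤ) * y ^ (0 : ℤ) * (f x * 1)
      - q * x ^ (0 : ℤ) * y ^ (-1 : ℤ) * (f x * 1))
      + (p * x ^ (0 : ℤ) * y ^ (0 : ℤ) * (1 * g y)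
        - p * x ^ (-1 : ℤ) * y ^ (0 : ℤ) * (1 * g y))) fun x hx y hy => by
    have hk := kernel_ne_zero_on_torus hp hq hr hρ hK hx hy
    have hx0 : x ≠ 0 := norm_pos_iff.1 (mem_sphere_zero_iff_norm.1 hx ▸ hρ)
    have hy0 : y ≠ 0 := norm_pos_iff.1 (mem_sphere_zero_iff_norm.1 hy ▸ hρ)
    have h1 : H x y * (x * y - p * y - q * x - r * x ^ 2 * y ^ 2)
        = q * x * (y - 1) * f x + p * y * (x - 1) * g y := by
      rw [hH, fhQuotient, div_mul_cancel₀ _ hk]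
    simp only [zpow_one, zpow_neg_one, zpow_zero, mul_one, one_mul]
    field_simp
    linear_combination h1
  rw [torusCoeff_sub hρ ((hcont.sub (cmon _ _ _ hcont)).sub (cmon _ _ _ hcont)) (cmon _ _ _ hcont),
    torusCoeff_sub hρ (hcont.sub (cmon _ _ _ hcont)) (cmon _ _ _ hcont),
    torusCoeff_sub hρ hcont (cmon _ _ _ hcont),
    torusCoeff_add hρ ((cmon (G := fun x y => f x * 1) _ _ _ cf).sub
      (cmon (G := fun x y => f x * 1) _ _ _ cf))
      ((cmon (G := fun x y => 1 * g y) _ _ _ cg).sub (cmon (G := fun x y => 1 * g y) _ _ _ cg)),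
    torusCoeff_sub hρ (cmon (G := fun x y => f x * 1) _ _ _ cf)
      (cmon (G := fun x y => f x * 1) _ _ _ cf),
    torusCoeff_sub hρ (cmon (G := fun x y => 1 * g y) _ _ _ cg)
      (cmon (G := fun x y => 1 * g y) _ _ _ cg)] at h
  simp only [torusCoeff_monomial_mul hρ, torusCoeff_mul _ (fun _ => 1),
    torusCoeff_mul (fun _ => 1), laurentCoeff_one hρ, sub_neg_eq_add, sub_zero] at h
  rw [h]
  ring

/-- If `q x (y - 1) f(x) + p y (x - 1) g(y)` vanishes on the curve `K = 0` then `f` and `g` are the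
boundary values of a summable stationary array. -/
theorem exists_stationary_of_vanishing (hp : 0 < p) (hq : 0 < q) (hr : 0 < r) (hρ : 1 < ρ)
    (hR : ρ < R) (hK : p + q + r * ρ ^ 3 < ρ) (hrp : r * ρ ^ 3 < p) (hrq : r * ρ ^ 3 < q)
    (hf : DifferentiableOn ℂ f (ball 0 R)) (hg : DifferentiableOn ℂ g (ball 0 R))
    (hvx : ∀ x y : ℂ, ‖x‖ = ρ → ‖y‖ < ρ → x * y - p * y - q * x - r * x ^ 2 * y ^ 2 = 0 →
      q * x * (y - 1) * f x + p * y * (x - 1) * g y = 0)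
    (hvy : ∀ x y : ℂ, ‖x‖ < ρ → ‖y‖ = ρ → x * y - p * y - q * x - r * x ^ 2 * y ^ 2 = 0 →
      q * x * (y - 1) * f x + p * y * (x - 1) * g y = 0) :
    ∃ a : ℕ → ℕ → ℂ, Summable (fun n : ℕ × ℕ => a n.1 n.2) ∧
      (∀ m n, stationaryDefect (p : ℂ) q r a m n = 0) ∧
      (∀ x : ℂ, ‖x‖ ≤ 1 → HasSum (fun n => a n 0 * x ^ n) (f x)) ∧
      (∀ y : ℂ, ‖y‖ ≤ 1 → HasSum (fun n => a 0 n * y ^ n) (g y)) := by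
  have hρ0 : 0 < ρ := by linarith
  have hcOn := continuousOn_fhQuotient hp hq hr hρ0 hR hK hf hg
  have hcont : Continuous fun t : ℝ × ℝ =>
      fhQuotient p q r f g (circleMap 0 ρ t.1) (circleMap 0 ρ t.2) :=
    hcOn.comp_continuous (f := fun t : ℝ × ℝ => (circleMap 0 ρ t.1, circleMap 0 ρ t.2))
      (((continuous_circleMap 0 ρ).comp continuous_fst).prodMk
        ((continuous_circleMap 0 ρ).comp continuous_snd))
      fun t => ⟨circleMap_mem_sphere 0 hρ0.le _, circleMap_mem_sphere 0 hρ0.le _⟩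
  have hsnd : ∀ m n : ℤ, n < 0 → torusCoeff ρ (fhQuotient p q r f g) m n = 0 := fun m n hn =>
    torusCoeff_fhQuotient_eq_zero_of_snd_neg hp hq hr hρ0 hR hK hrq hg hcont hvx m hn
  have hfst : ∀ m n : ℤ, m < 0 → torusCoeff ρ (fhQuotient p q r f g) m n = 0 := fun m n hm =>
    torusCoeff_fhQuotient_eq_zero_of_fst_neg hp hq hr hρ0 hR hK hrp hf hcont hvy hm n
  have hrec := torusCoeff_fhQuotient_recurrence hp hq hr hρ0 hR hK hf hg hcont
  obtain ⟨M, hM⟩ := ((isCompact_sphere (0 : ℂ) ρ).prod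
    (isCompact_sphere (0 : ℂ) ρ)).exists_bound_of_continuousOn hcOn
  have hbound := norm_torusCoeff_le (H := fhQuotient p q r f g) (M := M) hρ0
    fun x hx y hy => hM (x, y) ⟨hx, hy⟩
  set c := torusCoeff ρ (fhQuotient p q r f g)
  have hdisc : ∀ {f : ℂ → ℂ}, DifferentiableOn ℂ f (ball 0 R) → DiffContOnCl ℂ f (ball 0 ρ) :=
    fun hf => DifferentiableOn.diffContOnCl
      (hf.mono (by rw [closure_ball _ hρ0.ne']; exact closedBall_subset_ball hR))
  have hp' : (p : ℂ) ≠ 0 := mod_cast hp.ne'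
  have hq' : (q : ℂ) ≠ 0 := mod_cast hq.ne'
  -- At second index -1 all coefficients with a negative index drop out of the recurrence, leaving
  -- -q c(n, 0) = -q fₙ.
  have hcol : ∀ n : ℕ, c n 0 = laurentCoeff ρ f n := fun n => by
    have h := hrec n (-1)
    rw [hsnd n (-1) (by omega), hsnd _ (-1 - 1) (by omega), hsnd _ (-1) (by omega),
      laurentCoeff_eq_zero hρ0 (hdisc hg) (by omega : (-1 : ℤ) < 0)] at h
    simp at h
    exact h.resolve_right hq.ne'
  have hrow : ∀ n : ℕ, c 0 n = laurentCoeff ρ g n := fun n => by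
    have h := hrec (-1) n
    rw [hfst (-1) n (by omega), hfst (-1 - 1) _ (by omega), hfst (-1) _ (by omega),
      laurentCoeff_eq_zero hρ0 (hdisc hf) (by omega : (-1 : ℤ) < 0)] at h
    simp at h
    exact h.resolve_right hp.ne'
  refine ⟨fun m n => c m n, ?_, fun m n => ?_, fun x hx => ?_, fun y hy => ?_⟩
  -- The Cauchy bound M ρ^(-m-n) is summable because ρ > 1.
  · have hgeo : Summable fun n : ℕ => (ρ⁻¹) ^ n :=
      summable_geometric_of_lt_one (by positivity) (inv_lt_one_of_one_lt₀ hρ)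
    refine Summable.of_norm_bounded ((hgeo.mul_of_nonneg hgeo (fun n => by positivity)
      (fun n => by positivity)).mul_left M) fun n => ?_
    simpa [zpow_neg, inv_pow] using hbound n.1 n.2
  · have h := hrec m n
    rw [if_neg (by omega : ¬ (n : ℤ) + 1 = 0), if_neg (by omega : ¬ (m : ℤ) + 1 = 0)] at h
    have h1 : (if 1 ≤ m ∧ 1 ≤ n then (r : ℂ) * c ((m - 1 : ℕ) : ℤ) ((n - 1 : ℕ) : ℤ) else 0)
        = r * c (m - 1) (n - 1) := by
      split_ifs with hmn
      · rw [Nat.cast_sub hmn.1, Nat.cast_sub hmn.2, Nat.cast_one]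
      · rcases not_and_or.1 hmn with hm | hn
        · rw [hfst _ _ (by omega), mul_zero]
        · rw [hsnd _ _ (by omega), mul_zero]
    have h2 : (if m = 0 then (p : ℂ) * c ((0 : ℕ) : ℤ) n else 0)
        = p * laurentCoeff ρ g n * if (m : ℤ) = 0 then 1 else 0 := by
      rw [Nat.cast_zero, hrow]
      simp
    have h3 : (if n = 0 then (q : ℂ) * c m ((0 : ℕ) : ℤ) else 0)
        = q * laurentCoeff ρ f m * if (n : ℤ) = 0 then 1 else 0 := by
      rw [Nat.cast_zero, hcol]
      simp
    rw [stationaryDefect, h1, h2, h3, Nat.cast_add, Nat.cast_add, Nat.cast_one]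
    linear_combination h
  · simp only [Nat.cast_zero, hcol]
    exact hasSum_laurentCoeff hρ0 (hdisc hf) (hx.trans_lt hρ)
  · simp only [Nat.cast_zero, hrow]
    exact hasSum_laurentCoeff hρ0 (hdisc hg) (hy.trans_lt hρ)

end Division

end Torus

/-! ### Choice of radii and assembly -/

section Main

variable {p q r w : ℝ}

/-- Most conditions are strict at 1 and persist just above it. The two inequations keep the apparent
singularities p/q and q/p off the circle of radius ρ. -/
theorem exists_radii (hp : 0 < p) (hq : 0 < q) (hpqr : p + q + r = 1) (hrp : r < p)
    (hrq : r < q) (hcp : p * r * w ^ 2 < 1) (hcq : q * r * w ^ 2 < 1) (hrw : r * w < 1) :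
    ∃ ρ R : ℝ, 1 < ρ ∧ ρ < R ∧ p + q + r * ρ ^ 3 < ρ ∧ r * ρ ^ 3 < p ∧ r * ρ ^ 3 < q ∧
      r * w * ρ ^ 2 < 1 ∧ ρ * q ≠ p ∧ ρ * p ≠ q ∧ R * (q * r * w ^ 2) ≤ 1 ∧
      R * (p * r * w ^ 2) ≤ 1 ∧ r * R ≤ p ∧ r * R ≤ q := by
  have hev : ∀ {F : ℝ → ℝ} {b : ℝ}, Continuous F → F 1 < b →
      ∀ᶠ z in nhdsWithin 1 (Set.Ioi 1), F z < b := fun hF h =>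
    (hF.continuousAt.eventually_lt_const h).filter_mono nhdsWithin_le_nhds
  have hne : ∀ {s t : ℝ}, 0 < s → ∀ᶠ z in nhdsWithin 1 (Set.Ioi 1), z * s ≠ t := fun {s t} hs => by
    by_cases h : t / s = 1
    · filter_upwards [self_mem_nhdsWithin] with z hz hzt
      rw [← hzt, mul_div_cancel_right₀ _ hs.ne'] at h
      exact (Set.mem_Ioi.1 hz).ne' h
    · filter_upwards [nhdsWithin_le_nhds (isOpen_ne.mem_nhds (Ne.symm h))] with z hz hzt
      exact hz (by rw [← hzt, mul_div_cancel_right₀ _ hs.ne'])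
  have hgt := Filter.eventually_mem_set.2 (self_mem_nhdsWithin (a := (1 : ℝ)) (s := Set.Ioi 1))
  obtain ⟨R, hR1, h1, h2, h3, h4⟩ := (hgt.and <|
    (hev (F := fun R => R * (q * r * w ^ 2)) (b := 1) (by fun_prop) (by linarith)).and <|
    (hev (F := fun R => R * (p * r * w ^ 2)) (b := 1) (by fun_prop) (by linarith)).and <|
    (hev (F := fun R => r * R) (b := p) (by fun_prop) (by linarith)).and
    (hev (F := fun R => r * R) (b := q) (by fun_prop) (by linarith))).exists
  obtain ⟨ρ, hρ1, hρR, h5, h6, h7, h8, h9, h10⟩ :=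
    (hgt.and <|
    (hev (F := fun z => z) (b := R) (by fun_prop) hR1).and <|
    (hev (F := fun z => r * (1 + z + z ^ 2)) (b := 1) (by fun_prop) (by linarith)).and <|
    (hev (F := fun z => r * z ^ 3) (b := p) (by fun_prop) (by linarith)).and <|
    (hev (F := fun z => r * z ^ 3) (b := q) (by fun_prop) (by linarith)).and <|
    (hev (F := fun z => r * w * z ^ 2) (b := 1) (by fun_prop) (by linarith)).and <|
    (hne (t := p) hq).and (hne (t := q) hp)).exists
  have hρ1' : 1 < ρ := hρ1
  refine ⟨ρ, R, hρ1, hρR, ?_, h6, h7, h8, h9, h10, h1.le, h2.le, h3.le, h4.le⟩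
  -- The kernel condition is an equality at ρ = 1, but ρ - p - q - rρ³ = (ρ - 1)(1 - r(1 + ρ + ρ²)),
  -- and 3r < 1.
  have := mul_pos (sub_pos.2 hρ1') (sub_pos.2 h5)
  nlinarith

theorem one_sub_mul_div_ne_zero {ρ : ℝ} (hp : 0 < p) (hq : 0 < q) (h : ρ * q ≠ p) {x : ℂ}
    (hx : ‖x‖ = ρ) : 1 - q * x / p ≠ 0 := by
  intro h0
  have hp' : (p : ℂ) ≠ 0 := mod_cast hp.ne'
  have h1 : x * q = p := by
    field_simp at h0
    linear_combination -h0
  have h2 := congrArg norm h1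
  rw [norm_mul, Complex.norm_of_nonneg hp.le, Complex.norm_of_nonneg hq.le, hx] at h2
  exact h h2

theorem exists_isFHSolution (hp : 0 < p) (hq : 0 < q) (hr : 0 < r) (hpqr : p + q + r = 1)
    (hrp : r < p) (hrq : r < q) (hw : w = 2 + p * q * r * w ^ 3) (hw0 : 0 < w)
    (hcp : p * r * w ^ 2 < 1) (hcq : q * r * w ^ 2 < 1) (hrw : r * w < 1) :
    ∃ Q : ℂ → ℂ → ℂ, IsFHSolution p q r Q ∧
      (∀ x : ℂ, ‖x‖ ≤ 1 → Q x 0 = fhBoundary p q r w x) ∧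
      (∀ y : ℂ, ‖y‖ ≤ 1 → Q 0 y = fhBoundary q p r w y) := by
  obtain ⟨ρ, R, hρ, hR, hK, h1, h2, h3, h4, h5, h6, h7, h8, h9⟩ :=
    exists_radii hp hq hpqr hrp hrq hcp hcq hrw
  have hρ0 : 0 < ρ := by linarith
  have hw' : w = 2 + q * p * r * w ^ 3 := by rwa [mul_comm q p]
  have hnorm : ∀ {x y : ℂ}, ‖x‖ ≤ ρ → ‖y‖ ≤ ρ → 0 < (1 - r * w * (x * y)).re := by
    intro x y hx hy
    refine re_one_sub_pos ?_
    rw [norm_mul, norm_mul, norm_mul, Complex.norm_of_nonneg hr.le, Complex.norm_of_nonneg hw0.le]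
    refine lt_of_le_of_lt ?_ h3
    rw [sq]
    gcongr
  -- Stated for arbitrary p and q so that the exchanged pair covers the other circle.
  have hvan : ∀ {p q : ℝ}, 0 < p → 0 < q → p + q + r = 1 → w = 2 + p * q * r * w ^ 3 →
      p * r * w ^ 2 < 1 → q * r * w ^ 2 < 1 → R * (q * r * w ^ 2) ≤ 1 →
      R * (p * r * w ^ 2) ≤ 1 → r * R ≤ p → r * R ≤ q → ρ * p ≠ q → ∀ x y : ℂ, ‖x‖ < ρ → ‖y‖ = ρ →
      x * y - p * y - q * x - r * x ^ 2 * y ^ 2 = 0 →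
      q * x * (y - 1) * fhBoundary p q r w x + p * y * (x - 1) * fhBoundary q p r w y = 0 := by
    intro p q hp hq hpqr hw hcp hcq h6 h7 h8 h9 h5 x y hx hy hk
    have hxR := hx.trans hR
    have hyR := hy.trans_lt hR
    exact fhBoundary_vanishing hp hq hpqr hw hw0 hcp hcq hrw
      (re_one_sub_pos (norm_mul_mul_lt_one hq hr h6 hxR))
      (re_one_sub_pos (norm_mul_mul_lt_one hp hr h7 hyR)) (hnorm hx.le hy.le)
      (one_sub_ne_zero_of_norm_lt (norm_mul_div_lt_one hp hr h8 hxR))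
      (one_sub_ne_zero_of_norm_lt (norm_mul_div_lt_one hq hr h9 hyR))
      (one_sub_mul_div_ne_zero hq hp h5 hy) hk
  obtain ⟨a, ha, hst, hrow, hcol⟩ := exists_stationary_of_vanishing hp hq hr hρ hR hK h1 h2
    (differentiableOn_fhBoundary hp hq hr hcp h6 h8)
    (differentiableOn_fhBoundary hq hp hr hcq h7 h9)
    (fun x y hx hy hk => by
      rw [← hvan hq hp (by linarith) hw' hcq hcp h7 h6 h9 h8 h4 y x hy hx
        (by linear_combination hk)]
      ring)
    (hvan hp hq hpqr hw hcp hcq h6 h7 h8 h9 h5)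
  have hexp : ∀ x y : ℂ, ‖x‖ ≤ 1 → ‖y‖ ≤ 1 →
      HasSum (fun n : ℕ × ℕ => a n.1 n.2 * x ^ n.1 * y ^ n.2)
        (∑' n : ℕ × ℕ, a n.1 n.2 * x ^ n.1 * y ^ n.2) := fun x y hx hy =>
    (summable_mul_pow_mul_pow ha hx hy).hasSum
  refine ⟨_, isFHSolution_of_stationaryDefect hexp hst, fun x hx => ?_, fun y hy => ?_⟩
  · exact (hasSum_of_hasSum_snd_zero (hexp x 0 hx (by simp))).unique (hrow x hx)
  · exact (hasSum_of_hasSum_fst_zero (hexp 0 y (by simp) hy)).unique (hcol y hy)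

theorem fhBoundary_eq_div (hp : 0 < p) (hq : 0 < q) (hr : 0 < r) (hrp : r < p) (hw0 : 0 < w)
    (hcp : p * r * w ^ 2 < 1) (hcq : q * r * w ^ 2 < 1) {x : ℂ} (hx : ‖x‖ ≤ 1)
    (hqx : q * x ≠ p) :
    fhBoundary p q r w x = 1 / ((1 - q * x / p) * (1 - r * x / p)) *
      ((1 - x / (p * w)) * Complex.sqrt (1 - x * q * r * w ^ 2)
        - q * x / p * (1 - 1 / (q * w)) * Complex.sqrt (1 - p * r * w ^ 2)) := by
  have hp' : (p : ℂ) ≠ 0 := mod_cast hp.ne'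
  have hone : ∀ {s : ℝ}, 0 < s → s * r * w ^ 2 < 1 → ∀ {x : ℂ}, ‖x‖ ≤ 1 →
      0 < (1 - x * s * r * w ^ 2).re := fun {s} hs hc x hx =>
    re_one_sub_pos (norm_mul_mul_lt_one (R := 1 / (s * r * w ^ 2)) hs hr
      (by rw [one_div_mul_cancel (by positivity)])
      (hx.trans_lt ((one_lt_div (by positivity)).2 hc)))
  have hrx : 1 - r * x / p ≠ 0 := one_sub_ne_zero_of_norm_lt
    (norm_mul_div_lt_one (R := p / r) hp hr (by rw [mul_div_cancel₀ _ hr.ne'])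
      (hx.trans_lt ((one_lt_div hr).2 hrp)))
  have hqx' : 1 - q * x / p ≠ 0 := fun h => hqx (by
    field_simp at h
    linear_combination -h)
  rw [← mul_fhBoundary hp.ne' hq.ne' hw0.ne' (hone hq hcq hx)
    (by simpa using hone hp hcp (x := 1) (by simp)) hrx, ← mul_assoc,
    one_div_mul_cancel (mul_ne_zero hqx' hrx), one_mul]

/-- With pw = 1 the second summand vanishes and a square root is left over its own square. -/
theorem fhBoundary_eq_of_mul_eq_one (hp : 0 < p) (hr : 0 < r) (hrp : r < p) (hpw : w = 1 / p)
    {x : ℂ} (hx : ‖x‖ ≤ 1) : fhBoundary p p r w x = 1 / Complex.sqrt (1 - r * x / p) := by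
  have hp' : (p : ℂ) ≠ 0 := mod_cast hp.ne'
  have hlt : ‖r * x / p‖ < 1 := norm_mul_div_lt_one (R := p / r) hp hr
    (by rw [mul_div_cancel₀ _ hr.ne']) (hx.trans_lt ((one_lt_div hr).2 hrp))
  have h0 := one_sub_ne_zero_of_norm_lt hlt
  have h1 : (1 : ℂ) - x * p * r * w ^ 2 = 1 - r * x / p := by
    rw [hpw]
    push_cast
    field_simp
  have h2 : (p : ℂ) * w - 1 = 0 := by
    rw [hpw]
    push_cast
    field_simp
    ring
  have hs := Complex.sqrt_sq (1 - r * x / p)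
  have hs0 : Complex.sqrt (1 - r * x / p) ≠ 0 := fun h => h0 (by rw [← hs, h]; simp)
  rw [fhBoundary, h1, h2, mul_zero, zero_div, add_zero, div_eq_div_iff h0 hs0, one_mul, ← sq, hs]

end Main

theorem mainTheorem2 (p q r : ℝ) (hp : 0 < p) (hq : 0 < q) (hr : 0 < r) (hpqr : p + q + r = 1) :
    (r < min p q →
      ∃ w : ℝ, IsLeast {z : ℝ | 0 < z ∧ z = 2 + p * q * r * z ^ 3} w ∧
        -- existence of a nonzero solution, unique up to a multiplicative constant
        (∃ Q₀ : ℂ → ℂ → ℂ, IsFHSolution p q r Q₀ ∧ NonzeroOnPolydisc Q₀ ∧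
          ∀ Q : ℂ → ℂ → ℂ, IsFHSolution p q r Q →
            ∃ c : ℂ, ∀ x y : ℂ, ‖x‖ ≤ 1 → ‖y‖ ≤ 1 → Q x y = c * Q₀ x y) ∧
        -- explicit expressions
        (∀ Q : ℂ → ℂ → ℂ, IsFHSolution p q r Q →
          (∀ x : ℂ, ‖x‖ ≤ 1 → q * x ≠ p →
            Q x 0 = Q 0 0 / ((1 - q * x / p) * (1 - r * x / p)) *
              ((1 - x / (p * w)) * Complex.sqrt (1 - x * q * r * w ^ 2)
                - q * x / p * (1 - 1 / (q * w)) * Complex.sqrt (1 - p * r * w ^ 2))) ∧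
          (∀ y : ℂ, ‖y‖ ≤ 1 → p * y ≠ q →
            Q 0 y = Q 0 0 / ((1 - p * y / q) * (1 - r * y / q)) *
              ((1 - y / (q * w)) * Complex.sqrt (1 - y * p * r * w ^ 2)
                - p * y / q * (1 - 1 / (p * w)) * Complex.sqrt (1 - q * r * w ^ 2))) ∧
          (∀ x y : ℂ, ‖x‖ ≤ 1 → ‖y‖ ≤ 1 → x ≠ 0 → y ≠ 0 → fhKernel p q r x y ≠ 0 →
            Q x y = (q * (1 - 1 / y) * Q x 0 + p * (1 - 1 / x) * Q 0 y) / fhKernel p q r x y)) ∧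
        -- the symmetric case
        (p = q → w = 1 / p ∧
          ∀ Q : ℂ → ℂ → ℂ, IsFHSolution p q r Q → ∀ x : ℂ, ‖x‖ ≤ 1 →
            Q x 0 = Q 0 0 / Complex.sqrt (1 - r * x / p) ∧
            Q 0 x = Q 0 0 / Complex.sqrt (1 - r * x / p))) ∧
    (min p q ≤ r →
      ¬ ∃ Q : ℂ → ℂ → ℂ, IsFHSolution p q r Q ∧ NonzeroOnPolydisc Q) := by
  refine ⟨fun hlt => ?_, fun hle => ?_⟩
  · obtain ⟨hrp, hrq⟩ := lt_min_iff.1 hlt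
    obtain ⟨w, hw⟩ := exists_isLeast_root hp hq hr hpqr
    have hw0 : 0 < w := hw.1.1
    have hcq : q * r * w ^ 2 < 1 := hw.mul_mul_sq_lt_one hp hq hr hpqr hrq.ne
    have hcp : p * r * w ^ 2 < 1 :=
      hw.swap_root.mul_mul_sq_lt_one hq hp hr (by linarith) hrp.ne
    -- Here w ≤ 3, while r < p and r < q give 3r < 1.
    have hrw : r * w < 1 := by
      have := hw.root_le_three hp hq hr hpqr
      nlinarith
    obtain ⟨Q₀, hQ₀, hrow, hcol⟩ :=
      exists_isFHSolution hp hq hr hpqr hrp hrq hw.1.2 hw0 hcp hcq hrw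
    have h00 : Q₀ 0 0 = 1 := by rw [hrow 0 (by simp), fhBoundary_zero]
    have hrow' : ∀ Q : ℂ → ℂ → ℂ, IsFHSolution p q r Q → ∀ x : ℂ, ‖x‖ ≤ 1 →
        Q x 0 = Q 0 0 * fhBoundary p q r w x := fun Q hQ x hx => by
      rw [hQ₀.eq_mul hp hq hr hpqr h00 hQ hx (by simp), hrow x hx]
    have hcol' : ∀ Q : ℂ → ℂ → ℂ, IsFHSolution p q r Q → ∀ y : ℂ, ‖y‖ ≤ 1 →
        Q 0 y = Q 0 0 * fhBoundary q p r w y := fun Q hQ y hy => by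
      rw [hQ₀.eq_mul hp hq hr hpqr h00 hQ (by simp) hy, hcol y hy]
    refine ⟨w, hw, ⟨Q₀, hQ₀, ⟨0, 0, by simp, by simp, by simp [h00]⟩, fun Q hQ =>
      ⟨Q 0 0, fun x y hx hy => hQ₀.eq_mul hp hq hr hpqr h00 hQ hx hy⟩⟩, fun Q hQ =>
      ⟨fun x hx hqx => ?_, fun y hy hpy => ?_, fun x y hx hy hx0 hy0 hk => ?_⟩, fun hpq => ?_⟩
    · rw [hrow' Q hQ x hx, fhBoundary_eq_div hp hq hr hrp hw0 hcp hcq hx hqx, ← mul_assoc,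
        mul_one_div]
    · rw [hcol' Q hQ y hy, fhBoundary_eq_div hq hp hr hrq hw0 hcq hcp hy hpy, ← mul_assoc,
        mul_one_div]
    · rw [eq_div_iff hk, mul_comm]
      exact hQ.equation_closed hx hy hx0 hy0
    · have hw1 := hw.root_eq_of_eq hp hr hpqr hpq hrp
      subst hpq
      refine ⟨hw1, fun Q hQ x hx => ⟨?_, ?_⟩⟩
      · rw [hrow' Q hQ x hx, fhBoundary_eq_of_mul_eq_one hp hr hrp hw1 hx, mul_one_div]
      · rw [hcol' Q hQ x hx, fhBoundary_eq_of_mul_eq_one hp hr hrp hw1 hx, mul_one_div]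
  · rintro ⟨Q, hQ, x, y, hx, hy, hne⟩
    exact hne (hQ.eq_zero_of_min_le hp hq hr hpqr hle hx hy)
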